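/- Let $n\ge 1$ and $0\le r\le n$ be integers and write $[n]=\{1,\dots,n\}$. Let $$A^*(U_{n,n})=\frac{\mathbb{Z}[x_S : \emptyset\ne S\subseteq[n]]}{\langle x_Sx_T : S\not\subseteq T,\ T\not\subseteq S\rangle+\langle \sum_{S\ni e}x_S : e\in[n]\rangle},$$ graded by $\deg x_S=1$, with the symmetric group $S_n$ acting by $\sigma(x_S)=x_{\sigma(S)}$. For the uniform matroid $U_{r,n}$ of rank $r$ on $[n]$, with rank function $\mathrm{rk}(S)=\min(|S|,r)$ and nullity $\mathrm{null}(S)=|S|-\mathrm{rk}(S)$, let $$y_{i,j}=\sum_{\emptyset\ne S\subseteq[n],\ \mathrm{rk}(S)=i,\ \mathrm{null}(S)=j}x_S\qquad(0\le i,j\le n),$$ let the rank-nullity ring $R^*(U_{r,n})$ be the subring of $A^*(U_{n,n})$ generated by all the $y_{i,j}$, and let $R^d(U_{r,n})=R^*(U_{r,n})\cap A^d(U_{n,n})$. Then $R^*(U_{r,n})=A^*(U_{n,n})^{S_n}$, and for every $d\ge 0$ the group $R^d(U_{r,n})$ is free abelian of finite rank $$\mathrm{HF}(d):=\operatorname{rank}_{\mathbb{Z}}R^d(U_{r,n})=\binom{n-1}{d}.$$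 Consequently the Hilbert series is $\sum_{d\ge0}\mathrm{HF}(d)\,t^d=(1+t)^{n-1}$. More explicitly, put $z_l=\sum_{|S|=l}x_S$ for $1\le l\le n$. For every $d\ge 0$, the set $$\mathcal{B}_n^d=\Bigl\{z_{s_1}^{p_1}\cdots z_{s_l}^{p_l} : l\ge 0,\ s_i\le n,\ 1\le p_i<s_i-s_{i-1}\ (1\le i\le l),\ \textstyle\sum_i p_i=d\Bigr\}\qquad(s_0:=0)$$ is a $\mathbb{Z}$-basis of $R^d(U_{r,n})$, and the following map is a bijection from the set of $d$-element subsets of $[n-1]$ onto $\mathcal{B}_n^d$: if $S=I_1\sqcup\dots\sqcup I_l$ is the decomposition of $S$ into maximal intervals of consecutive integers and $b_j=\max I_j$, then $S\mapsto\prod_{j=1}^l z_{b_j+1}^{|I_j|}$. -/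

import Mathlib

noncomputable section

/-- The uniform matroid `U_{r,n}` on `Fin n`: a set is independent iff it has at most `r`
elements. -/
def uniformMatroid (r n : ℕ) : Matroid (Fin n) :=
  (IndepMatroid.ofFinite (E := Set.univ) Set.finite_univ (fun I => I.ncard ≤ r)
    (by simp)
    (fun _ J hJ hIJ => (Set.ncard_le_ncard hIJ J.toFinite).trans hJ)
    (by
      intro I J _ hJ hlt
      obtain ⟨e, heJ, heI⟩ := Set.exists_mem_notMem_of_ncard_lt_ncard hlt I.toFinite
      exact ⟨e, heJ, heI, by rw [Set.ncard_insert_of_notMem heI I.toFinite]; omega⟩)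
    (fun _ _ => Set.subset_univ _)).matroid

/-- The rank function of a matroid on `Fin n`. -/
def matroidRank {n : ℕ} (M : Matroid (Fin n)) (S : Finset (Fin n)) : ℕ :=
  (M.eRk (S : Set (Fin n))).toNat

/-- The nullity function of a matroid on `Fin n`. The rank of `S` is at most `|S|`, so the
subtraction is never truncated. -/
def matroidNullity {n : ℕ} (M : Matroid (Fin n)) (S : Finset (Fin n)) : ℕ :=
  S.card - matroidRank M S

/-- The index set of the variables `x_S`: the nonempty subsets `S` of the ground set. -/
abbrev NonemptySubset (n : ℕ) : Type := {S : Finset (Fin n) // S.Nonempty}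

/-- The ideal of relations of the Chow ring `A^*(U_{n,n})`: products `x_S x_T` with `S`, `T`
incomparable, and the linear forms `∑_{S ∋ e} x_S`. -/
def chowIdeal (n : ℕ) : Ideal (MvPolynomial (NonemptySubset n) ℤ) :=
  Ideal.span
    ({f | ∃ S T : NonemptySubset n, ¬ S.1 ⊆ T.1 ∧ ¬ T.1 ⊆ S.1 ∧
        f = MvPolynomial.X S * MvPolynomial.X T} ∪
     {f | ∃ e : Fin n,
        f = ∑ S ∈ Finset.univ.filter (fun S : NonemptySubset n => e ∈ S.1), MvPolynomial.X S})

/-- The Chow ring `A^*(U_{n,n})` of the free matroid on `n` elements. -/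
abbrev FreeChowRing (n : ℕ) : Type := MvPolynomial (NonemptySubset n) ℤ ⧸ chowIdeal n

/-- The class of the variable `x_S` in `A^*(U_{n,n})`. -/
def chowX {n : ℕ} (S : NonemptySubset n) : FreeChowRing n :=
  Ideal.Quotient.mk (chowIdeal n) (MvPolynomial.X S)

/-- The graded piece `A^d(U_{n,n})`: classes of homogeneous polynomials of degree `d`. -/
def chowDegree (n d : ℕ) : Submodule ℤ (FreeChowRing n) :=
  (MvPolynomial.homogeneousSubmodule (NonemptySubset n) ℤ d).map
    (Ideal.Quotient.mkₐ ℤ (chowIdeal n)).toLinearMap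

/-- The action of a permutation of the ground set on nonempty subsets. -/
def permSubset {n : ℕ} (σ : Equiv.Perm (Fin n)) (S : NonemptySubset n) : NonemptySubset n :=
  ⟨S.1.map σ.toEmbedding, S.2.map⟩

theorem chowIdeal_le_comap {n : ℕ} (σ : Equiv.Perm (Fin n)) :
    chowIdeal n ≤ (chowIdeal n).comap
      (MvPolynomial.rename (R := ℤ) (permSubset σ)).toRingHom := by
  rw [chowIdeal, Ideal.span_le]
  rintro f (⟨S, T, hST, hTS, rfl⟩ | ⟨e, rfl⟩)
  · apply Ideal.subset_span
    refine Or.inl ⟨permSubset σ S, permSubset σ T, ?_, ?_, by simp⟩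
    · simpa [permSubset] using hST
    · simpa [permSubset] using hTS
  · apply Ideal.subset_span
    refine Or.inr ⟨σ e, ?_⟩
    simp only [AlgHom.toRingHom_eq_coe, RingHom.coe_coe, map_sum, MvPolynomial.rename_X]
    refine Finset.sum_bij' (fun S _ => permSubset σ S) (fun S _ => permSubset σ.symm S)
      ?_ ?_ ?_ ?_ ?_
    · intro S hS
      simpa [permSubset] using hS
    · intro S hS
      simpa [permSubset, Equiv.symm_apply_eq] using hS
    · intro S _
      apply Subtype.ext
      ext a
      simp [permSubset]
    · intro S _
      apply Subtype.ext
      ext a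
      simp [permSubset]
    · intro S _
      rfl

/-- The action of `σ ∈ S_n` on `A^*(U_{n,n})`, given by `x_S ↦ x_{σ(S)}`. -/
def chowPerm {n : ℕ} (σ : Equiv.Perm (Fin n)) : FreeChowRing n →+* FreeChowRing n :=
  Ideal.quotientMap (chowIdeal n) (MvPolynomial.rename (R := ℤ) (permSubset σ)).toRingHom
    (chowIdeal_le_comap σ)

/-- The invariant subring `A^*(U_{n,n})^{S_n}`, as a set. -/
def chowInvariants (n : ℕ) : Set (FreeChowRing n) :=
  {f | ∀ σ : Equiv.Perm (Fin n), chowPerm σ f = f}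

/-- The generator `y_{i,j}`: the sum of the `x_S` over the nonempty sets `S` of rank `i` and
nullity `j`. -/
def rankNullityGen {n : ℕ} (M : Matroid (Fin n)) (i j : ℕ) : FreeChowRing n :=
  ∑ S ∈ Finset.univ.filter
    (fun S : NonemptySubset n => matroidRank M S.1 = i ∧ matroidNullity M S.1 = j), chowX S

/-- The rank-nullity ring `R^*(M)` of a matroid `M` with ground set all of `Fin n`. -/
def rankNullityRing {n : ℕ} (M : Matroid (Fin n)) : Subalgebra ℤ (FreeChowRing n) :=
  Algebra.adjoin ℤ {f | ∃ i j : ℕ, i ≤ n ∧ j ≤ n ∧ f = rankNullityGen M i j}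

/-- The degree-`d` part `R^d(M)` of the graded subring `R^*(M)` of `A^*(U_{n,n})`. -/
def rankNullityDegree {n : ℕ} (M : Matroid (Fin n)) (d : ℕ) : Submodule ℤ (FreeChowRing n) :=
  Subalgebra.toSubmodule (rankNullityRing M) ⊓ chowDegree n d

/-- The Hilbert function of `R^*(M)`. -/
def hilbertFunction {n : ℕ} (M : Matroid (Fin n)) (d : ℕ) : ℕ :=
  Module.finrank ℤ (rankNullityDegree M d)

/-- The Hilbert series of `R^*(M)`. -/
def hilbertSeries {n : ℕ} (M : Matroid (Fin n)) : PowerSeries ℤ :=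
  PowerSeries.mk (fun d => (hilbertFunction M d : ℤ))

/-- The element `z_l`: the sum of the `x_S` over the sets `S` with `l` elements. -/
def chowZ (n l : ℕ) : FreeChowRing n :=
  ∑ S ∈ Finset.univ.filter (fun S : NonemptySubset n => S.1.card = l), chowX S

/-- The set `B_n^d` of monomials `z_{s_1}^{p_1} ⋯ z_{s_l}^{p_l}` with `s_i ≤ n`,
`1 ≤ p_i < s_i - s_{i-1}` (where `s_0 = 0`) and `p_1 + ⋯ + p_l = d`. Here `p i` stands for
`p_{i+1}`. -/
def basisMonomials (n d : ℕ) : Set (FreeChowRing n) :=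
  {f | ∃ (l : ℕ) (s : Fin (l + 1) → ℕ) (p : Fin l → ℕ),
    s 0 = 0 ∧ (∀ i, s i ≤ n) ∧
    (∀ i : Fin l, 1 ≤ p i ∧ s i.castSucc + p i < s i.succ) ∧
    ∑ i, p i = d ∧
    f = ∏ i : Fin l, chowZ n (s i.succ) ^ p i}

/-- The right endpoints of the maximal intervals of consecutive numbers in `S`. -/
def rightEnds (S : Finset ℕ) : Finset ℕ := S.filter (fun b => b + 1 ∉ S)

/-- The maximal interval of consecutive numbers in `S` with right endpoint `b ∈ S`. -/
def intervalEndingAt (S : Finset ℕ) (b : ℕ) : Finset ℕ :=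
  S.filter (fun a => a ≤ b ∧ Finset.Icc a b ⊆ S)

/-- The monomial `∏_j z_{b_j + 1}^{|I_j|}` attached to `S = I_1 ⊔ ⋯ ⊔ I_l`, the decomposition of
`S` into maximal intervals of consecutive numbers, `I_j` having right endpoint `b_j`. -/
def subsetMonomial (n : ℕ) (S : Finset ℕ) : FreeChowRing n :=
  ∏ b ∈ rightEnds S, chowZ n (b + 1) ^ (intervalEndingAt S b).card

end

/-! The Chow ring has the Feichtner–Yuzvinsky (FY) basis: the monomials `∏ x_{S_i}^{p_i}` over
chains `S_1 ⊂ ⋯ ⊂ S_l` with `1 ≤ p_i < |S_i| - |S_{i-1}|`, `|S_0| = 0`. Permutations of the ground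
set permute this basis. Two basis monomials share an orbit exactly when they have the same exponents
size by size, and an orbit sum is a monomial `∏ z_{s_i}^{p_i}` (`chowZMonomial_eq_sum`). Hence these
products are a `ℤ`-basis of the invariants. For a uniform matroid, size determines rank and nullity,
so every `y_{i,j}` is `0` or `z_{i+j}` and the rank-nullity ring is the invariant ring. Replacing
`z_s^p` by the interval `[s-p, s-1]` turns the exponent bounds into "the intervals lie in `[n-1]`
and do not touch", which counts the basis by `d`-subsets.

The FY basis itself is established in two halves. Spanning (`chowWeightSpan_le_fySpan`): a monomial
violating the bounds is zero or can be rewritten by monomials of the same degree with larger weight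
`∑ m(S)|S|`, which is bounded. Independence (`linearIndependent_chowMonomial`): deform the linear
relations to `∑_{S ∋ e} x_S = e + 1` and evaluate at `n!` points, one for each maximal chain. Modulo
lower degree, evaluation respects the original relations, so the evaluated FY monomials span all
functions on these points. There are at most `n!` of them, so they are independent, and independence
passes back to the Chow ring one degree at a time. -/

noncomputable section

/-! ### Counting Feichtner–Yuzvinsky exponent vectors -/

-- The sum telescopes, its `j`-th term being `k!/(j-1)! - k!/j!` for `j ≥ 1`. At `j = 0` the
-- truncated `j - 1` makes the term vanish.
open Finset in
theorem sum_choose_mul_factorial_mul_pred (k J : ℕ) (hJ : J ≤ k) :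
    ∑ j ∈ range (J + 1), k.choose j * ((j - 1) * (k - j).factorial)
      + k.choose J * (k - J).factorial = k.factorial := by
  induction J with
  | zero => simp
  | succ J ih =>
    rw [← ih (by omega), sum_range_succ _ (J + 1), add_assoc]
    congr 1
    obtain ⟨i, rfl⟩ : ∃ i, k = J + 1 + i := ⟨k - (J + 1), by omega⟩
    have h := Nat.choose_succ_right_eq (J + 1 + i) J
    have e1 : J + 1 + i - (J + 1) = i := by omega
    have e2 : J + 1 + i - J = i + 1 := by omega
    rw [e2] at h
    rw [e1, e2, Nat.factorial_succ]
    simp only [Nat.add_sub_cancel]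
    calc _ = ((J + 1 + i).choose (J + 1) * (J + 1)) * i.factorial := by ring
      _ = _ := by rw [h]; ring

/-- The exponent vectors of the Feichtner–Yuzvinsky monomials `∏ x_{S_i}^{p_i}` relative to `F`:
`F ⊂ S_1 ⊂ ⋯ ⊂ S_l` is a chain and `p_i < |S_i| - |S_{i-1}|`, where `S_0 = F`. -/
def IsFYExponent {n : ℕ} (F : Finset (Fin n)) (m : NonemptySubset n →₀ ℕ) : Prop :=
  ∀ S ∈ m.support, F ⊆ S.1 ∧ m S + F.card < S.1.card ∧
    ∀ T ∈ m.support, T = S ∨ (T.1 ⊂ S.1 ∧ m S + T.1.card < S.1.card) ∨ S.1 ⊂ T.1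

theorem IsFYExponent.erase {n : ℕ} {F : Finset (Fin n)} {m : NonemptySubset n →₀ ℕ}
    (h : IsFYExponent F m) {S : NonemptySubset n} (hS : S ∈ m.support)
    (hmin : ∀ T ∈ m.support, S.1.card ≤ T.1.card) : IsFYExponent S.1 (m.erase S) := by
  intro T hT
  rw [Finsupp.support_erase, Finset.mem_erase] at hT
  obtain ⟨hTS, hT⟩ := hT
  have hST : S.1 ⊂ T.1 ∧ m T + S.1.card < T.1.card := by
    rcases (h T hT).2.2 S hS with h1 | h1 | h1
    · exact absurd h1.symm hTS
    · exact h1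
    · exact absurd (Finset.card_lt_card h1) (by have := hmin T hT; omega)
  rw [Finsupp.erase_ne hTS]
  refine ⟨hST.1.subset, hST.2, fun U hU => ?_⟩
  rw [Finsupp.support_erase, Finset.mem_erase] at hU
  exact (h T hT).2.2 U hU.2

-- Grouping by `S \ F` gives the telescoping identity at `J = k = n - |F|`. The left side is the
-- recursion for the number of FY vectors relative to `F`, with `+ 1` for the zero vector.
open Finset in
theorem sum_ssuperset_card_mul_factorial {n : ℕ} (F : Finset (Fin n)) :
    ∑ S ∈ univ.filter (fun S : NonemptySubset n => F ⊂ S.1),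
      (S.1.card - F.card - 1) * (n - S.1.card).factorial + 1 ≤ (n - F.card).factorial := by
  have hk : Fᶜ.card = n - F.card := by rw [card_compl, Fintype.card_fin]
  have key := sum_choose_mul_factorial_mul_pred (n - F.card) (n - F.card) le_rfl
  simp only [Nat.choose_self, Nat.sub_self, Nat.factorial_zero, mul_one] at key
  rw [← key, ← hk]
  have h2 := Finset.sum_powerset_apply_card (x := Fᶜ)
    (fun j => (j - 1) * (Fᶜ.card - j).factorial)
  simp only [smul_eq_mul] at h2
  rw [← h2]
  gcongr
  have hinj : Set.InjOn (fun S : NonemptySubset n => S.1 \ F)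
      (univ.filter (fun S : NonemptySubset n => F ⊂ S.1) : Finset (NonemptySubset n)) := by
    intro S hS T hT hST
    simp only [coe_filter, mem_univ, true_and, Set.mem_ofPred_eq] at hS hT hST
    apply Subtype.ext
    rw [← sdiff_union_of_subset hS.subset, hST, sdiff_union_of_subset hT.subset]
  refine (Eq.trans_le ?_ (sum_le_sum_of_subset (f := fun U : Finset (Fin n) =>
    (U.card - 1) * (Fᶜ.card - U.card).factorial) (s := (univ.filter
      (fun S : NonemptySubset n => F ⊂ S.1)).image (fun S => S.1 \ F)) ?_))
  · rw [sum_image hinj]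
    refine sum_congr rfl fun S hS => ?_
    have hS' : F ⊂ S.1 := by simpa using hS
    rw [card_sdiff_of_subset hS'.subset, hk]
    have h1 := card_lt_card hS'
    congr 2
    omega
  · intro U hU
    obtain ⟨S, _, rfl⟩ := mem_image.1 hU
    rw [mem_powerset, subset_compl_iff_disjoint_right]
    exact sdiff_disjoint

/-- A nonzero vector is determined by the smallest set `S` of its chain, the exponent of `S`, which
is one of `1, …, |S| - |F| - 1`, and the remaining vector, which is FY relative to `S`. -/
theorem exists_finset_fyExponent {n : ℕ} (F : Finset (Fin n)) :
    ∃ s : Finset (NonemptySubset n →₀ ℕ),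
      (∀ m, IsFYExponent F m → m ∈ s) ∧ s.card ≤ (n - F.card).factorial := by
  classical
  induction hk : n - F.card using Nat.strong_induction_on generalizing F with
  | _ k ih =>
  subst hk
  have ih' : ∀ S : NonemptySubset n, ∃ s : Finset (NonemptySubset n →₀ ℕ), F ⊂ S.1 →
      (∀ m, IsFYExponent S.1 m → m ∈ s) ∧ s.card ≤ (n - S.1.card).factorial := by
    intro S
    by_cases hS : F ⊂ S.1
    · have h1 := Finset.card_lt_card hS
      have h2 := Finset.card_le_univ S.1
      rw [Fintype.card_fin] at h2
      obtain ⟨s, hs⟩ := ih (n - S.1.card) (by omega) S.1 rfl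
      exact ⟨s, fun _ => hs⟩
    · exact ⟨∅, fun h => absurd h hS⟩
  choose s hs using ih'
  refine ⟨insert 0 ((Finset.univ.filter (fun S : NonemptySubset n => F ⊂ S.1)).biUnion fun S =>
    (Finset.Ico 1 (S.1.card - F.card)).biUnion fun p =>
      (s S).image fun m => m + Finsupp.single S p), ?_, ?_⟩
  · intro m hm
    by_cases h0 : m = 0
    · simp [h0]
    · obtain ⟨S, hS, hmin⟩ := Finset.exists_min_image m.support (fun S => S.1.card)
        (Finsupp.support_nonempty_iff.2 h0)
      have h1 := hm S hS
      have hlt : F ⊂ S.1 := by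
        refine Finset.ssubset_iff_subset_ne.2 ⟨h1.1, fun h => ?_⟩
        have := h1.2.1
        rw [h] at this
        omega
      have h3 : m S ≠ 0 := Finsupp.mem_support_iff.1 hS
      refine Finset.mem_insert_of_mem (Finset.mem_biUnion.2 ⟨S, by simpa using hlt,
        Finset.mem_biUnion.2 ⟨m S, Finset.mem_Ico.2 ⟨by omega, by omega⟩,
          Finset.mem_image.2 ⟨m.erase S, (hs S hlt).1 _ (hm.erase hS hmin),
            Finsupp.erase_add_single S m⟩⟩⟩)
  · refine (Finset.card_insert_le _ _).trans ((Nat.add_le_add_right ?_ 1).trans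
      (sum_ssuperset_card_mul_factorial F))
    refine Finset.card_biUnion_le.trans (Finset.sum_le_sum fun S hS => ?_)
    refine Finset.card_biUnion_le.trans ?_
    refine (Finset.sum_le_card_nsmul _ _ (n - S.1.card).factorial fun p _ =>
      Finset.card_image_le.trans (hs S (by simpa using hS)).2).trans ?_
    simp

/-! ### Feichtner–Yuzvinsky monomials span the Chow ring -/

theorem chowX_mul_chowX_eq_zero {n : ℕ} {S T : NonemptySubset n} (h1 : ¬ S.1 ⊆ T.1)
    (h2 : ¬ T.1 ⊆ S.1) : chowX S * chowX T = 0 := by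
  rw [chowX, chowX, ← map_mul, Ideal.Quotient.eq_zero_iff_mem]
  exact Ideal.subset_span (Or.inl ⟨S, T, h1, h2, rfl⟩)

theorem sum_chowX_mem_eq_zero {n : ℕ} (e : Fin n) :
    ∑ S ∈ Finset.univ.filter (fun S : NonemptySubset n => e ∈ S.1), chowX S = 0 := by
  simp only [chowX]
  rw [← map_sum, Ideal.Quotient.eq_zero_iff_mem]
  exact Ideal.subset_span (Or.inr ⟨e, rfl⟩)

/-- The sum of the `x_T` over the sets `T` that contain `G`. -/
def chowUpper {n : ℕ} (G : Finset (Fin n)) : FreeChowRing n :=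
  ∑ T ∈ Finset.univ.filter (fun T : NonemptySubset n => G ⊆ T.1), chowX T

open Classical in
/-- `x_F`, with the convention `x_∅ = 1`. -/
def chowFlat {n : ℕ} (F : Finset (Fin n)) : FreeChowRing n :=
  if h : F.Nonempty then chowX ⟨F, h⟩ else 1

theorem chowFlat_coe {n : ℕ} (S : NonemptySubset n) : chowFlat S.1 = chowX S := by
  rw [chowFlat, dif_pos S.2]

theorem chowFlat_mul_chowX_eq_zero {n : ℕ} {F : Finset (Fin n)} {S : NonemptySubset n}
    (h1 : ¬ F ⊆ S.1) (h2 : ¬ S.1 ⊆ F) : chowFlat F * chowX S = 0 := by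
  have hF : F.Nonempty := by
    rw [Finset.nonempty_iff_ne_empty]
    rintro rfl
    exact h1 (Finset.empty_subset _)
  rw [← chowX_mul_chowX_eq_zero (S := ⟨F, hF⟩) h1 h2, chowFlat, dif_pos hF]

/-- Multiply the linear relation of `e` by `x_F`: a set that contains `e` but not `F` is
incomparable with `F`. -/
theorem chowFlat_mul_chowUpper_insert {n : ℕ} {F : Finset (Fin n)} {e : Fin n} (he : e ∉ F) :
    chowFlat F * chowUpper (insert e F) = 0 := by
  have h := congrArg (chowFlat F * ·) (sum_chowX_mem_eq_zero e)
  simp only [mul_zero] at h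
  rw [← h, chowUpper, Finset.mul_sum, Finset.mul_sum]
  refine Finset.sum_subset (fun S hS => ?_) fun S hS hS' => ?_
  · simp only [Finset.mem_filter, Finset.mem_univ, true_and] at hS ⊢
    exact hS (Finset.mem_insert_self _ _)
  · simp only [Finset.mem_filter, Finset.mem_univ, true_and, Finset.insert_subset_iff] at hS hS'
    exact chowFlat_mul_chowX_eq_zero (fun h => hS' ⟨hS, h⟩) fun h => he (h hS)

theorem chowX_mul_chowUpper {n : ℕ} (S : NonemptySubset n) {G : Finset (Fin n)}
    (hG : ¬ G ⊆ S.1) : chowX S * chowUpper G = chowX S * chowUpper (G ∪ S.1) := by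
  rw [chowUpper, chowUpper, Finset.mul_sum, Finset.mul_sum]
  symm
  refine Finset.sum_subset (fun T hT => ?_) fun T hT hT' => ?_
  · simp only [Finset.mem_filter, Finset.mem_univ, true_and] at hT ⊢
    exact Finset.subset_union_left.trans hT
  · simp only [Finset.mem_filter, Finset.mem_univ, true_and, Finset.union_subset_iff] at hT hT'
    simp only [hT, true_and] at hT'
    exact chowX_mul_chowX_eq_zero hT' fun h => hG (hT.trans h)

theorem mul_pow_eq_mul_pow {R : Type*} [CommRing R] {a b c : R} (h : a * b = a * c) (k : ℕ) :
    a * b ^ k = a * c ^ k := by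
  induction k with
  | zero => simp
  | succ k ih => rw [pow_succ, ← mul_assoc, ih, mul_right_comm, h, mul_right_comm, mul_assoc,
      ← pow_succ]

/-- The source of the exponent bounds. For `e ∈ G \ F`, `chowUpper G` is `chowUpper (insert e F)`,
which `x_F` kills, minus the `x_S` with `insert e F ⊆ S` and `¬ G ⊆ S`. Multiplication by such an
`x_S` turns `G` into `G ∪ S`, which exceeds `S` by fewer elements than `G` exceeds `F`, so induction
kills the remaining power. -/
theorem chowFlat_mul_chowUpper_pow {n : ℕ} (k : ℕ) {F G : Finset (Fin n)} (h : F ⊂ G)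
    (hk : (G \ F).card ≤ k) : chowFlat F * chowUpper G ^ k = 0 := by
  induction k generalizing F G with
  | zero =>
    have := Finset.sdiff_nonempty.2 h.2
    rw [← Finset.card_pos] at this
    omega
  | succ k ih =>
    obtain ⟨e, he⟩ := Finset.sdiff_nonempty.2 h.2
    rw [Finset.mem_sdiff] at he
    have hsplit : chowUpper (insert e F) = chowUpper G + ∑ S ∈ Finset.univ.filter
        (fun S : NonemptySubset n => insert e F ⊆ S.1 ∧ ¬ G ⊆ S.1), chowX S := by
      rw [chowUpper, ← Finset.sum_filter_add_sum_filter_not _ (fun S : NonemptySubset n => G ⊆ S.1),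
        Finset.filter_filter, Finset.filter_filter, chowUpper]
      congr 2
      ext S
      simp only [Finset.mem_filter, Finset.mem_univ, true_and, and_iff_right_iff_imp]
      exact fun hS => (Finset.insert_subset he.1 h.subset).trans hS
    have hzero : (∑ S ∈ Finset.univ.filter
        (fun S : NonemptySubset n => insert e F ⊆ S.1 ∧ ¬ G ⊆ S.1), chowX S) *
          chowUpper G ^ k = 0 := by
      rw [Finset.sum_mul]
      refine Finset.sum_eq_zero fun S hS => ?_
      simp only [Finset.mem_filter, Finset.mem_univ, true_and, Finset.insert_subset_iff] at hS
      rw [mul_pow_eq_mul_pow (chowX_mul_chowUpper S hS.2) k, ← chowFlat_coe]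
      refine ih ⟨Finset.subset_union_right, fun h' => hS.2 (Finset.subset_union_left.trans h')⟩ ?_
      rw [Finset.union_sdiff_right]
      refine Nat.le_of_lt_succ (lt_of_lt_of_le (Finset.card_lt_card ?_) hk)
      refine ⟨Finset.sdiff_subset_sdiff subset_rfl hS.1.2, fun h' => ?_⟩
      exact (Finset.mem_sdiff.1 (h' (Finset.mem_sdiff.2 he))).2 hS.1.1
    have h1 := chowFlat_mul_chowUpper_insert he.2
    rw [hsplit] at h1
    calc chowFlat F * chowUpper G ^ (k + 1)
        = (chowFlat F * (chowUpper G + ∑ S ∈ Finset.univ.filter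
            (fun S : NonemptySubset n => insert e F ⊆ S.1 ∧ ¬ G ⊆ S.1), chowX S)) * chowUpper G ^ k
          - chowFlat F * ((∑ S ∈ Finset.univ.filter
            (fun S : NonemptySubset n => insert e F ⊆ S.1 ∧ ¬ G ⊆ S.1), chowX S)
              * chowUpper G ^ k) := by ring
      _ = 0 := by rw [h1, hzero]; simp

/-- The class of the monomial with exponent vector `m`. -/
def chowMonomial {n : ℕ} (m : NonemptySubset n →₀ ℕ) : FreeChowRing n :=
  Ideal.Quotient.mk (chowIdeal n) (MvPolynomial.monomial m 1)

theorem chowMonomial_add {n : ℕ} (m m' : NonemptySubset n →₀ ℕ) :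
    chowMonomial (m + m') = chowMonomial m * chowMonomial m' := by
  rw [chowMonomial, chowMonomial, chowMonomial, ← map_mul, MvPolynomial.monomial_mul, one_mul]

theorem chowMonomial_single {n : ℕ} (S : NonemptySubset n) (k : ℕ) :
    chowMonomial (Finsupp.single S k) = chowX S ^ k := by
  rw [chowMonomial, chowX, ← map_pow, MvPolynomial.X_pow_eq_monomial]

/-- The weight `∑ m(S) |S|` of an exponent vector. -/
def chowWeight {n : ℕ} : (NonemptySubset n →₀ ℕ) →+ ℕ :=
  Finsupp.weight fun S : NonemptySubset n => S.1.card

theorem chowWeight_single {n : ℕ} (S : NonemptySubset n) (k : ℕ) :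
    chowWeight (Finsupp.single S k) = k * S.1.card := by
  simp [chowWeight, Finsupp.weight_single]

theorem chowWeight_le {n : ℕ} (m : NonemptySubset n →₀ ℕ) : chowWeight m ≤ m.degree * n := by
  rw [chowWeight, Finsupp.weight_apply, Finsupp.sum, Finsupp.degree_apply, Finset.sum_mul]
  refine Finset.sum_le_sum fun S _ => ?_
  rw [smul_eq_mul]
  exact Nat.mul_le_mul_left _ ((Finset.card_le_univ S.1).trans_eq (Fintype.card_fin n))

/-- The span of the monomials of degree `d` and weight at least `w`. -/
def chowWeightSpan (n d w : ℕ) : Submodule ℤ (FreeChowRing n) :=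
  Submodule.span ℤ {f | ∃ m : NonemptySubset n →₀ ℕ, m.degree = d ∧ w ≤ chowWeight m ∧
    chowMonomial m = f}

theorem chowMonomial_mem_weightSpan {n : ℕ} (m : NonemptySubset n →₀ ℕ) :
    chowMonomial m ∈ chowWeightSpan n m.degree (chowWeight m) :=
  Submodule.subset_span ⟨m, rfl, le_rfl, rfl⟩

theorem chowWeightSpan_anti {n d w w' : ℕ} (h : w ≤ w') :
    chowWeightSpan n d w' ≤ chowWeightSpan n d w :=
  Submodule.span_mono fun _ ⟨m, h1, h2, h3⟩ => ⟨m, h1, h.trans h2, h3⟩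

theorem mul_mem_chowWeightSpan {n d w d' w' : ℕ} {a b : FreeChowRing n}
    (ha : a ∈ chowWeightSpan n d w) (hb : b ∈ chowWeightSpan n d' w') :
    a * b ∈ chowWeightSpan n (d + d') (w + w') := by
  have h := Submodule.mul_mem_mul ha hb
  rw [chowWeightSpan, chowWeightSpan, Submodule.span_mul_span] at h
  refine Submodule.span_mono ?_ h
  rintro _ ⟨_, ⟨m, h1, h2, rfl⟩, _, ⟨m', h1', h2', rfl⟩, rfl⟩
  exact ⟨m + m', by rw [map_add, h1, h1'], by rw [map_add]; omega, chowMonomial_add m m'⟩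

theorem chowX_mem_weightSpan {n : ℕ} (S : NonemptySubset n) :
    chowX S ∈ chowWeightSpan n 1 S.1.card := by
  have h := chowMonomial_mem_weightSpan (Finsupp.single S 1)
  rwa [chowMonomial_single, pow_one, chowWeight_single, one_mul, Finsupp.degree_single] at h

theorem chowUpper_sub_mem_weightSpan {n : ℕ} (S : NonemptySubset n) :
    chowUpper S.1 - chowX S ∈ chowWeightSpan n 1 (S.1.card + 1) := by
  classical
  rw [chowUpper, ← Finset.sum_erase_add _ _ (show S ∈ Finset.univ.filter
    (fun T : NonemptySubset n => S.1 ⊆ T.1) by simp), add_sub_cancel_right]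
  refine Submodule.sum_mem _ fun T hT => ?_
  simp only [Finset.mem_erase, Finset.mem_filter, Finset.mem_univ, true_and] at hT
  refine chowWeightSpan_anti (Nat.succ_le_of_lt (Finset.card_lt_card ?_)) (chowX_mem_weightSpan T)
  exact Finset.ssubset_iff_subset_ne.2 ⟨hT.2, fun h => hT.1 (Subtype.ext h.symm)⟩

theorem chowX_pow_mem_weightSpan {n : ℕ} (S : NonemptySubset n) (k : ℕ) :
    chowX S ^ k ∈ chowWeightSpan n k (k * S.1.card) := by
  have h := chowMonomial_mem_weightSpan (Finsupp.single S k)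
  rwa [chowMonomial_single, chowWeight_single, Finsupp.degree_single] at h

theorem chowUpper_pow_sub_mem_weightSpan {n : ℕ} (S : NonemptySubset n) (k : ℕ) :
    chowUpper S.1 ^ k - chowX S ^ k ∈ chowWeightSpan n k (k * S.1.card + 1) := by
  induction k with
  | zero => simp
  | succ k ih =>
    have h1 := chowUpper_sub_mem_weightSpan S
    have h2 : chowUpper S.1 ∈ chowWeightSpan n 1 S.1.card := by
      have := add_mem (chowWeightSpan_anti (Nat.le_succ _) h1) (chowX_mem_weightSpan S)
      rwa [sub_add_cancel] at this
    have h3 := add_mem (mul_mem_chowWeightSpan ih h2)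
      (chowWeightSpan_anti (w := k * S.1.card + 1 + S.1.card) (by omega)
        (mul_mem_chowWeightSpan (chowX_pow_mem_weightSpan S k) h1))
    convert h3 using 1
    · congr 1
      ring
    · ring

/-- The span of the Feichtner–Yuzvinsky monomials of degree `d`. -/
def fySpan (n d : ℕ) : Submodule ℤ (FreeChowRing n) :=
  Submodule.span ℤ {f | ∃ m : NonemptySubset n →₀ ℕ, IsFYExponent ∅ m ∧ m.degree = d ∧
    chowMonomial m = f}

theorem chowMonomial_eq_zero {n : ℕ} {m : NonemptySubset n →₀ ℕ} {S T : NonemptySubset n}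
    (hS : S ∈ m.support) (hT : T ∈ m.support) (h1 : ¬ S.1 ⊆ T.1) (h2 : ¬ T.1 ⊆ S.1) :
    chowMonomial m = 0 := by
  classical
  have hle : Finsupp.single S 1 + Finsupp.single T 1 ≤ m := by
    intro U
    rw [Finsupp.mem_support_iff] at hS hT
    have hne : S ≠ T := fun h => h1 (by rw [h])
    simp only [Finsupp.add_apply, Finsupp.single_apply]
    split_ifs with ha hb hb
    · exact absurd (ha.trans hb.symm) hne
    · subst ha; omega
    · subst hb; omega
    · omega
  obtain ⟨m', rfl⟩ := exists_add_of_le hle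
  rw [chowMonomial_add, chowMonomial_add, chowMonomial_single, chowMonomial_single, pow_one,
    pow_one, chowX_mul_chowX_eq_zero h1 h2, zero_mul]

/-- With `k = |S \ F|`, the product `x_F * chowUpper S ^ k` vanishes and `x_S ^ k` is the
lowest-weight term of `chowUpper S ^ k`. So `x_F * x_S ^ k` equals a combination of monomials of
larger weight. -/
theorem chowMonomial_mem_of_large_exponent {n : ℕ} {m : NonemptySubset n →₀ ℕ}
    {S : NonemptySubset n} {F : Finset (Fin n)} (hFS : F ⊂ S.1) (hle : S.1.card ≤ m S + F.card)
    (hF : F = ∅ ∨ ∃ T ∈ m.support, T.1 = F) :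
    chowMonomial m ∈ chowWeightSpan n m.degree (chowWeight m + 1) := by
  classical
  set k := (S.1 \ F).card with hk
  have hk' : k ≤ m S := by
    rw [hk, Finset.card_sdiff_of_subset hFS.subset]; omega
  obtain ⟨m', hm⟩ := exists_add_of_le (Finsupp.single_le_iff.2 hk')
  obtain ⟨c, hc⟩ : ∃ c, chowMonomial m' = c * chowFlat F := by
    rcases hF with rfl | ⟨T, hT, rfl⟩
    · exact ⟨chowMonomial m', by simp [chowFlat]⟩
    · have hTm : Finsupp.single T 1 ≤ m' := by
        rw [Finsupp.single_le_iff]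
        have hne : S ≠ T := by rintro rfl; exact hFS.2 subset_rfl
        rw [hm, Finsupp.mem_support_iff, Finsupp.add_apply, Finsupp.single_apply,
          if_neg hne] at hT
        omega
      obtain ⟨m'', rfl⟩ := exists_add_of_le hTm
      exact ⟨chowMonomial m'', by rw [chowMonomial_add, chowMonomial_single, pow_one,
        chowFlat_coe, mul_comm]⟩
  have h0 := chowFlat_mul_chowUpper_pow k hFS le_rfl
  have hrw : chowMonomial m = -(chowMonomial m' * (chowUpper S.1 ^ k - chowX S ^ k)) := by
    rw [hm, chowMonomial_add, chowMonomial_single, mul_sub, hc, mul_assoc, h0]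
    ring
  rw [hrw]
  have h1 := mul_mem_chowWeightSpan (chowMonomial_mem_weightSpan m')
    (chowUpper_pow_sub_mem_weightSpan S k)
  refine neg_mem ?_
  convert h1 using 2
  · rw [hm, map_add, Finsupp.degree_single, add_comm]
  · rw [hm, map_add, chowWeight_single]; ring

/-- A vector fails to be FY in three ways: an exponent too large relative to `∅`, an exponent too
large relative to a smaller set `T` of the support, or an incomparable pair, which makes the
monomial zero. -/
theorem chowMonomial_mem_fySpan_sup {n : ℕ} (m : NonemptySubset n →₀ ℕ) :
    chowMonomial m ∈ fySpan n m.degree ⊔ chowWeightSpan n m.degree (chowWeight m + 1) := by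
  by_cases hm : IsFYExponent ∅ m
  · exact Submodule.mem_sup_left (Submodule.subset_span ⟨m, hm, rfl, rfl⟩)
  refine Submodule.mem_sup_right ?_
  simp only [IsFYExponent, not_forall, exists_prop] at hm
  obtain ⟨S, hS, hm⟩ := hm
  by_cases h1 : S.1.card ≤ m S
  · exact chowMonomial_mem_of_large_exponent (S := S) (F := ∅)
      (Finset.empty_ssubset.2 S.2) (by simpa using h1) (Or.inl rfl)
  simp only [Finset.empty_subset, Finset.card_empty, add_zero, not_le.1 h1, true_and, not_forall,
    exists_prop, not_or, not_and] at hm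
  obtain ⟨T, hT, hne, h2, h3⟩ := hm
  have hST : ¬ S.1 ⊆ T.1 := fun h =>
    h3 (Finset.ssubset_iff_subset_ne.2 ⟨h, fun h' => hne (Subtype.ext h'.symm)⟩)
  by_cases h4 : T.1 ⊆ S.1
  · have h5 : T.1 ⊂ S.1 := ⟨h4, hST⟩
    exact chowMonomial_mem_of_large_exponent h5 (not_lt.1 (h2 h5)) (Or.inr ⟨T, hT, rfl⟩)
  · rw [chowMonomial_eq_zero hS hT hST h4]
    exact zero_mem _

/-- Weights in degree `d` are at most `d * n`, so raising the weight terminates. The induction runs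
downwards in `w`. -/
theorem chowWeightSpan_le_fySpan (n d w : ℕ) : chowWeightSpan n d w ≤ fySpan n d := by
  induction hk : d * n + 1 - w generalizing w with
  | zero =>
    rw [chowWeightSpan, Submodule.span_le]
    rintro _ ⟨m, rfl, h2, rfl⟩
    have := chowWeight_le m
    omega
  | succ k ih =>
    rw [chowWeightSpan, Submodule.span_le]
    rintro _ ⟨m, rfl, h2, rfl⟩
    refine (sup_le le_rfl ?_ : _ ⊔ _ ≤ fySpan n m.degree) (chowMonomial_mem_fySpan_sup m)
    exact (chowWeightSpan_anti (Nat.succ_le_succ h2)).trans (ih (w + 1) (by omega))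

theorem chowMonomial_mem_fySpan {n : ℕ} (m : NonemptySubset n →₀ ℕ) :
    chowMonomial m ∈ fySpan n m.degree :=
  chowWeightSpan_le_fySpan _ _ _ (chowMonomial_mem_weightSpan m)

theorem mk_eq_sum_chowMonomial {n : ℕ} (f : MvPolynomial (NonemptySubset n) ℤ) :
    Ideal.Quotient.mk (chowIdeal n) f = ∑ m ∈ f.support, f.coeff m • chowMonomial m := by
  conv_lhs => rw [f.as_sum]
  rw [map_sum]
  refine Finset.sum_congr rfl fun m _ => ?_
  rw [chowMonomial, ← map_zsmul, MvPolynomial.smul_monomial, smul_eq_mul, mul_one]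

theorem chowDegree_eq_fySpan (n d : ℕ) : chowDegree n d = fySpan n d := by
  apply le_antisymm
  · rintro _ ⟨f, hf, rfl⟩
    change Ideal.Quotient.mk (chowIdeal n) f ∈ _
    rw [mk_eq_sum_chowMonomial]
    refine Submodule.sum_mem _ fun m hm => Submodule.smul_mem _ _ ?_
    have hd : m.degree = d := by
      by_contra h
      exact MvPolynomial.mem_support_iff.1 hm (MvPolynomial.IsHomogeneous.coeff_eq_zero hf h)
    rw [← hd]
    exact chowMonomial_mem_fySpan m
  · rw [fySpan, Submodule.span_le]
    rintro _ ⟨m, -, rfl, rfl⟩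
    exact ⟨_, MvPolynomial.isHomogeneous_monomial 1 rfl, rfl⟩

/-! ### Independence by evaluation at the maximal chains -/

/-- The first `k` elements in the order given by the positions `σ`. -/
def permPrefix {n : ℕ} (σ : Equiv.Perm (Fin n)) (k : ℕ) : Finset (Fin n) :=
  Finset.univ.filter fun e => (σ e : ℕ) < k

theorem mem_permPrefix {n : ℕ} {σ : Equiv.Perm (Fin n)} {k : ℕ} {e : Fin n} :
    e ∈ permPrefix σ k ↔ (σ e : ℕ) < k := by simp [permPrefix]

theorem card_permPrefix {n : ℕ} (σ : Equiv.Perm (Fin n)) {k : ℕ} (hk : k ≤ n) :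
    (permPrefix σ k).card = k := by
  have h : (permPrefix σ k).map σ.toEmbedding = Finset.univ.filter fun e : Fin n => (e : ℕ) < k := by
    ext e
    simp [mem_permPrefix, Finset.mem_map_equiv]
  rw [← Finset.card_map σ.toEmbedding, h, Fin.card_filter_val_lt, min_eq_right hk]

theorem permPrefix_mono {n : ℕ} (σ : Equiv.Perm (Fin n)) {k l : ℕ} (h : k ≤ l) :
    permPrefix σ k ⊆ permPrefix σ l := fun e he => by
  rw [mem_permPrefix] at he ⊢
  omega

/-- The value `e + 1` at the element `e` in position `k`, and `0` beyond the last position. -/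
def permLabel {n : ℕ} (σ : Equiv.Perm (Fin n)) (k : ℕ) : ℚ :=
  if h : k < n then ((σ.symm ⟨k, h⟩ : ℕ) : ℚ) + 1 else 0

/-- The value of `x_S` at the point of the maximal chain of `σ` at which all the linear forms
`∑_{S ∋ e} x_S` take the value `e + 1`. -/
def permPoint {n : ℕ} (σ : Equiv.Perm (Fin n)) (S : NonemptySubset n) : ℚ :=
  if S.1 = permPrefix σ S.1.card then permLabel σ (S.1.card - 1) - permLabel σ S.1.card else 0

/-- The values `e + 1` are distinct and also differ from the final label `0`, so no coordinate along
the chain vanishes. -/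
theorem permLabel_sub_ne_zero {n : ℕ} (σ : Equiv.Perm (Fin n)) {k : ℕ} (hk : k < n) :
    permLabel σ k - permLabel σ (k + 1) ≠ 0 := by
  rw [sub_ne_zero, permLabel, dif_pos hk, permLabel]
  split_ifs with h
  · intro h'
    have h2 : (σ.symm ⟨k, hk⟩ : ℕ) = σ.symm ⟨k + 1, h⟩ := by
      exact_mod_cast add_right_cancel h'
    have h3 := σ.symm.injective (Fin.ext h2)
    simp at h3
  · positivity

theorem permPoint_ne_zero_iff {n : ℕ} (σ : Equiv.Perm (Fin n)) (S : NonemptySubset n) :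
    permPoint σ S ≠ 0 ↔ S.1 = permPrefix σ S.1.card := by
  rw [permPoint]
  split_ifs with h
  · have h1 : 0 < S.1.card := Finset.card_pos.2 S.2
    have h2 : S.1.card ≤ n := (Finset.card_le_univ S.1).trans_eq (Fintype.card_fin n)
    have h3 := permLabel_sub_ne_zero σ (k := S.1.card - 1) (by omega)
    rw [Nat.sub_add_cancel h1] at h3
    exact iff_of_true h3 h
  · simp [h]

theorem permPoint_mul_eq_zero {n : ℕ} (σ : Equiv.Perm (Fin n)) {S T : NonemptySubset n}
    (h1 : ¬ S.1 ⊆ T.1) (h2 : ¬ T.1 ⊆ S.1) : permPoint σ S * permPoint σ T = 0 := by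
  by_contra h
  have hS := (permPoint_ne_zero_iff σ S).1 (left_ne_zero_of_mul h)
  have hT := (permPoint_ne_zero_iff σ T).1 (right_ne_zero_of_mul h)
  rcases le_total S.1.card T.1.card with hle | hle
  · exact h1 (by rw [hS, hT]; exact permPrefix_mono σ hle)
  · exact h2 (by rw [hS, hT]; exact permPrefix_mono σ hle)

theorem sum_permPoint {n : ℕ} (σ : Equiv.Perm (Fin n)) (e : Fin n) :
    ∑ S ∈ Finset.univ.filter (fun S : NonemptySubset n => e ∈ S.1), permPoint σ S = (e : ℚ) + 1 := by
  have h1 : ∑ S ∈ Finset.univ.filter (fun S : NonemptySubset n => e ∈ S.1), permPoint σ S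
      = ∑ k ∈ Finset.Ico (σ e : ℕ) n, (permLabel σ k - permLabel σ (k + 1)) := by
    simp only [permPoint]
    rw [← Finset.sum_filter, Finset.filter_filter]
    refine Finset.sum_nbij (fun S => S.1.card - 1) ?_ ?_ ?_ ?_
    · intro S hS
      simp only [Finset.mem_filter, Finset.mem_univ, true_and] at hS
      have h2 : S.1.card ≤ n := (Finset.card_le_univ S.1).trans_eq (Fintype.card_fin n)
      have h3 := hS.1
      rw [hS.2, mem_permPrefix] at h3
      rw [Finset.mem_Ico]
      omega
    · intro S hS T hT hST
      simp only [Finset.coe_filter, Finset.mem_univ, true_and, Set.mem_ofPred_eq] at hS hT hST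
      have h1 : 0 < S.1.card := Finset.card_pos.2 S.2
      have h2 : 0 < T.1.card := Finset.card_pos.2 T.2
      apply Subtype.ext
      rw [hS.2, hT.2, show S.1.card = T.1.card by omega]
    · intro k hk
      rw [Finset.coe_Ico, Set.mem_Ico] at hk
      have he : e ∈ permPrefix σ (k + 1) := mem_permPrefix.2 (by omega)
      have hc := card_permPrefix σ (k := k + 1) (by omega)
      refine ⟨⟨permPrefix σ (k + 1), ⟨e, he⟩⟩, ?_, ?_⟩
      · simp only [Finset.coe_filter, Finset.mem_univ, true_and, Set.mem_ofPred_eq]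
        exact ⟨he, by rw [hc]⟩
      · simp only [hc, Nat.add_sub_cancel]
    · intro S _
      rw [Nat.sub_add_cancel (Finset.card_pos.2 S.2)]
  rw [h1]
  have h2 := Finset.sum_Ico_sub (permLabel σ) (σ e).2.le
  rw [← neg_inj, ← Finset.sum_neg_distrib]
  simp only [neg_sub]
  rw [h2, permLabel, dif_neg (lt_irrefl _), permLabel, dif_pos (σ e).2]
  simp

/-- Evaluation of polynomials at the points of all the maximal chains. -/
def permEval (n : ℕ) : MvPolynomial (NonemptySubset n) ℤ →ₐ[ℤ] (Equiv.Perm (Fin n) → ℚ) :=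
  MvPolynomial.aeval fun S σ => permPoint σ S

theorem permEval_X {n : ℕ} (S : NonemptySubset n) (σ : Equiv.Perm (Fin n)) :
    permEval n (MvPolynomial.X S) σ = permPoint σ S := by
  rw [permEval, MvPolynomial.aeval_X]

theorem permEval_X_mul_X {n : ℕ} {S T : NonemptySubset n} (h1 : ¬ S.1 ⊆ T.1) (h2 : ¬ T.1 ⊆ S.1) :
    permEval n (MvPolynomial.X S * MvPolynomial.X T) = 0 := by
  ext σ
  rw [map_mul, Pi.mul_apply, permEval_X, permEval_X, permPoint_mul_eq_zero σ h1 h2, Pi.zero_apply]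

theorem permEval_sum_X {n : ℕ} (e : Fin n) :
    permEval n (∑ S ∈ Finset.univ.filter (fun S : NonemptySubset n => e ∈ S.1),
      MvPolynomial.X S) = fun _ => (e : ℚ) + 1 := by
  ext σ
  rw [map_sum, Finset.sum_apply, ← sum_permPoint σ e]
  exact Finset.sum_congr rfl fun S _ => permEval_X S σ

theorem permEval_monomial {n : ℕ} (m : NonemptySubset n →₀ ℕ) (c : ℤ) :
    permEval n (MvPolynomial.monomial m c) = (c : ℚ) • permEval n (MvPolynomial.monomial m 1) := by
  rw [← mul_one c, ← smul_eq_mul, ← MvPolynomial.smul_monomial, map_zsmul, smul_eq_mul, mul_one,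
    Int.cast_smul_eq_zsmul]

/-- The span of the evaluations of the monomials of degree less than `d`. -/
def evalSpan (n d : ℕ) : Submodule ℚ (Equiv.Perm (Fin n) → ℚ) :=
  Submodule.span ℚ {f | ∃ m : NonemptySubset n →₀ ℕ, m.degree < d ∧
    permEval n (MvPolynomial.monomial m 1) = f}

/-- Multiples of the quadratic relations evaluate to zero. A linear relation evaluates to the
constant `e + 1`, so a monomial times it evaluates like a scalar multiple of a monomial one degree
lower. The factor `a` lets the induction pass through ideal multiplication. -/
theorem permEval_homogeneousComponent_mul_mem {n : ℕ} {g : MvPolynomial (NonemptySubset n) ℤ}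
    (hg : g ∈ chowIdeal n) (a : MvPolynomial (NonemptySubset n) ℤ) (d : ℕ) :
    permEval n (MvPolynomial.homogeneousComponent d (a * g)) ∈ evalSpan n d := by
  rw [chowIdeal] at hg
  induction hg using Submodule.span_induction generalizing a with
  | zero => simp
  | add x y _ _ hx hy =>
    rw [mul_add, map_add, map_add]
    exact add_mem (hx a) (hy a)
  | smul b x _ hx =>
    rw [smul_eq_mul, ← mul_assoc]
    exact hx (a * b)
  | mem g hg =>
    induction a using MvPolynomial.induction_on' with
    | add p q hp hq =>
      rw [add_mul, map_add, map_add]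
      exact add_mem hp hq
    | monomial m c =>
      rcases hg with ⟨S, T, hST, hTS, rfl⟩ | ⟨e, rfl⟩
      · rw [MvPolynomial.homogeneousComponent_of_mem
          ((MvPolynomial.isHomogeneous_monomial c rfl).mul
            ((MvPolynomial.isHomogeneous_X _ S).mul (MvPolynomial.isHomogeneous_X _ T)))]
        split_ifs
        · rw [map_mul, permEval_X_mul_X hST hTS, mul_zero]
          exact zero_mem _
        · rw [map_zero]
          exact zero_mem _
      · rw [MvPolynomial.homogeneousComponent_of_mem
          ((MvPolynomial.isHomogeneous_monomial c rfl).mul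
            (MvPolynomial.IsHomogeneous.sum _ _ 1 fun S _ => MvPolynomial.isHomogeneous_X _ S))]
        split_ifs with h
        · have h1 : permEval n (MvPolynomial.monomial m c * ∑ S ∈ Finset.univ.filter
              (fun S : NonemptySubset n => e ∈ S.1), MvPolynomial.X S)
              = (((e : ℚ) + 1) * c) • permEval n (MvPolynomial.monomial m 1) := by
            rw [map_mul, permEval_sum_X, permEval_monomial]
            ext σ
            simp only [Pi.mul_apply, Pi.smul_apply, smul_eq_mul]
            ring
          rw [h1]
          exact Submodule.smul_mem _ _ (Submodule.subset_span ⟨m, by omega, rfl⟩)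
        · rw [map_zero]
          exact zero_mem _

theorem permEval_homogeneousComponent_mem {n : ℕ} {g : MvPolynomial (NonemptySubset n) ℤ}
    (hg : g ∈ chowIdeal n) (d : ℕ) :
    permEval n (MvPolynomial.homogeneousComponent d g) ∈ evalSpan n d := by
  simpa using permEval_homogeneousComponent_mul_mem hg 1 d

/-- The type of Feichtner–Yuzvinsky exponent vectors. -/
abbrev FYExponent (n : ℕ) : Type := {m : NonemptySubset n →₀ ℕ // IsFYExponent ∅ m}

/-- The evaluation of a Feichtner–Yuzvinsky monomial. -/
def fyEval (n : ℕ) (m : FYExponent n) : Equiv.Perm (Fin n) → ℚ :=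
  permEval n (MvPolynomial.monomial m.1 1)

/-- A monomial differs from an FY combination of its own degree by a homogeneous element of the
ideal, whose evaluation comes from strictly lower degree. -/
theorem evalSpan_le (n d : ℕ) :
    evalSpan n d ≤ Submodule.span ℚ (fyEval n '' {m | m.1.degree < d}) := by
  induction d using Nat.strong_induction_on with
  | _ d ih =>
  rw [evalSpan, Submodule.span_le]
  rintro _ ⟨m, hm, rfl⟩
  -- The spanning result is lifted to polynomials, because `permEval` does not kill the linear
  -- relations and so is not defined on the quotient.
  have h1 : fySpan n m.degree = (Submodule.span ℤ {f | ∃ m' : NonemptySubset n →₀ ℕ,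
      IsFYExponent ∅ m' ∧ m'.degree = m.degree ∧ MvPolynomial.monomial m' (1 : ℤ) = f}).map
        (Ideal.Quotient.mkₐ ℤ (chowIdeal n)).toLinearMap := by
    rw [Submodule.map_span, fySpan]
    congr 1
    ext f
    constructor
    · rintro ⟨m', h1, h2, rfl⟩
      exact ⟨_, ⟨m', h1, h2, rfl⟩, rfl⟩
    · rintro ⟨_, ⟨m', h1, h2, rfl⟩, rfl⟩
      exact ⟨m', h1, h2, rfl⟩
  have h2 := chowMonomial_mem_fySpan m
  rw [h1] at h2
  obtain ⟨f, hf, hfm⟩ := h2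
  have hhom : f.IsHomogeneous m.degree := by
    rw [← MvPolynomial.mem_homogeneousSubmodule]
    refine Submodule.span_le.2 ?_ hf
    rintro _ ⟨m', _, h', rfl⟩
    exact MvPolynomial.isHomogeneous_monomial 1 h'
  have hmhom : (MvPolynomial.monomial m (1 : ℤ)).IsHomogeneous m.degree :=
    MvPolynomial.isHomogeneous_monomial 1 rfl
  have hI : MvPolynomial.monomial m (1 : ℤ) - f ∈ chowIdeal n :=
    Ideal.Quotient.eq.1 hfm.symm
  have h3 := permEval_homogeneousComponent_mem hI m.degree
  rw [MvPolynomial.homogeneousComponent_of_mem (hmhom.sub hhom), if_pos rfl, map_sub] at h3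
  have h4 : permEval n (MvPolynomial.monomial m 1) - permEval n f ∈
      Submodule.span ℚ (fyEval n '' {m | m.1.degree < d}) :=
    Submodule.span_mono (Set.image_mono fun x (hx : _ < _) => hx.trans hm) (ih _ hm h3)
  have h5 : permEval n f ∈ Submodule.span ℚ (fyEval n '' {m | m.1.degree < d}) := by
    clear hfm hhom hI h3 h4
    induction hf using Submodule.span_induction with
    | zero => simp
    | add x y _ _ hx hy =>
      rw [map_add]
      exact add_mem hx hy
    | smul c x _ hx =>
      rw [map_zsmul]
      exact zsmul_mem hx c
    | mem x hx =>
      obtain ⟨m', h1, h2, rfl⟩ := hx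
      exact Submodule.subset_span ⟨⟨m', h1⟩, by simpa [h2] using hm, rfl⟩
  have := add_mem h4 h5
  rwa [sub_add_cancel] at this

/-- The product of all variables on the maximal chain of `σ` vanishes at every other point, since
the chain determines the ordering. -/
theorem single_mem_span_permEval {n : ℕ} (σ : Equiv.Perm (Fin n)) :
    ∃ (m : NonemptySubset n →₀ ℕ) (c : ℚ), c ≠ 0 ∧
      permEval n (MvPolynomial.monomial m 1) = Pi.single σ c := by
  classical
  set s := Finset.univ.filter (fun S : NonemptySubset n => S.1 = permPrefix σ S.1.card) with hs
  refine ⟨∑ S ∈ s, Finsupp.single S 1, ∏ S ∈ s, permPoint σ S, ?_, ?_⟩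
  · refine Finset.prod_ne_zero_iff.2 fun S hS => (permPoint_ne_zero_iff σ S).2 ?_
    simpa [hs] using hS
  · have h1 : MvPolynomial.monomial (∑ S ∈ s, Finsupp.single S 1) (1 : ℤ)
        = ∏ S ∈ s, MvPolynomial.X S := by
      rw [MvPolynomial.monomial_sum_one]
      rfl
    ext τ
    rw [h1, map_prod, Finset.prod_apply]
    simp only [permEval_X]
    by_cases hτ : τ = σ
    · subst hτ
      simp
    · rw [Pi.single_eq_of_ne hτ]
      by_contra h
      replace h := Finset.prod_ne_zero_iff.1 h
      have key : ∀ e, (σ e : ℕ) = τ e := by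
        have aux : ∀ k ≤ n, permPrefix σ k = permPrefix τ k := by
          intro k hk
          rcases Nat.eq_zero_or_pos k with rfl | h0
          · ext; simp [mem_permPrefix]
          · have hc := card_permPrefix σ hk
            have := (permPoint_ne_zero_iff τ _).1 (h ⟨permPrefix σ k, by
              rw [← Finset.card_pos]; omega⟩ (by simp [hs, hc]))
            simpa [hc] using this
        intro e
        have e1 : e ∈ permPrefix τ (σ e + 1) := by
          rw [← aux _ (σ e).2, mem_permPrefix]; omega
        have e2 : e ∈ permPrefix σ (τ e + 1) := by
          rw [aux _ (τ e).2, mem_permPrefix]; omega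
        rw [mem_permPrefix] at e1 e2
        omega
      exact hτ (Equiv.ext fun e => (Fin.ext (key e)).symm)

theorem span_fyEval (n : ℕ) : Submodule.span ℚ (Set.range (fyEval n)) = ⊤ := by
  classical
  rw [eq_top_iff]
  rintro f -
  rw [← Finset.univ_sum_single f]
  refine Submodule.sum_mem _ fun σ _ => ?_
  obtain ⟨m, c, hc, hm⟩ := single_mem_span_permEval σ
  have h1 : permEval n (MvPolynomial.monomial m 1) ∈ Submodule.span ℚ (Set.range (fyEval n)) :=
    Submodule.span_mono (Set.image_subset_range _ _)
      (evalSpan_le n (m.degree + 1) (Submodule.subset_span ⟨m, Nat.lt_succ_self _, rfl⟩))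
  have h2 := Submodule.smul_mem _ (f σ / c) h1
  rwa [hm, ← Pi.single_smul, smul_eq_mul, div_mul_cancel₀ _ hc] at h2

instance finite_fyExponent (n : ℕ) : Finite (FYExponent n) := by
  obtain ⟨s, hs, -⟩ := exists_finset_fyExponent (∅ : Finset (Fin n))
  exact Set.Finite.subset s.finite_toSet fun m hm => hs m hm

/-- A spanning family of at most `n!` vectors in a space of dimension `n!` is independent. -/
theorem linearIndependent_fyEval (n : ℕ) : LinearIndependent ℚ (fyEval n) := by
  classical
  have := Fintype.ofFinite (FYExponent n)
  refine linearIndependent_of_top_le_span_of_card_le_finrank (span_fyEval n).ge ?_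
  obtain ⟨s, hs, hcard⟩ := exists_finset_fyExponent (∅ : Finset (Fin n))
  rw [Module.finrank_fintype_fun_eq_card, Fintype.card_perm, Fintype.card_fin]
  rw [Finset.card_empty, Nat.sub_zero] at hcard
  refine le_trans ?_ hcard
  rw [← Finset.card_univ]
  exact Finset.card_le_card_of_injOn Subtype.val (fun m _ => hs m.1 m.2)
    Subtype.val_injective.injOn

/-- The degree-`d` part of a relation evaluates into the span of the FY evaluations of degree below
`d`, but is itself a combination of those of degree `d`. Independence of the evaluations makes these
spans disjoint and the coefficients zero. -/
theorem linearIndependent_chowMonomial (n : ℕ) :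
    LinearIndependent ℤ (fun m : FYExponent n => chowMonomial m.1) := by
  classical
  rw [linearIndependent_iff']
  intro s g hg i hi
  set G : MvPolynomial (NonemptySubset n) ℤ := ∑ m ∈ s, MvPolynomial.monomial m.1 (g m) with hG
  have hGI : G ∈ chowIdeal n := by
    rw [← Ideal.Quotient.eq_zero_iff_mem, ← hg, hG, map_sum]
    refine Finset.sum_congr rfl fun m _ => ?_
    rw [chowMonomial, ← map_zsmul, MvPolynomial.smul_monomial, smul_eq_mul, mul_one]
  set t := s.filter fun m => i.1.degree = m.1.degree with ht
  have h1 : permEval n (MvPolynomial.homogeneousComponent i.1.degree G)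
      = ∑ m ∈ t, (g m : ℚ) • fyEval n m := by
    rw [hG, map_sum, ht, Finset.sum_filter, map_sum]
    refine Finset.sum_congr rfl fun m _ => ?_
    rw [MvPolynomial.homogeneousComponent_of_mem (MvPolynomial.isHomogeneous_monomial _ rfl)]
    split_ifs
    · rw [permEval_monomial, fyEval]
    · rw [map_zero]
  have h2 := evalSpan_le _ _ (permEval_homogeneousComponent_mem hGI i.1.degree)
  rw [h1] at h2
  have h3 : ∑ m ∈ t, (g m : ℚ) • fyEval n m ∈
      Submodule.span ℚ (fyEval n '' {m | m.1.degree = i.1.degree}) :=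
    Submodule.sum_mem _ fun m hm => Submodule.smul_mem _ _ (Submodule.subset_span
      ⟨m, (Finset.mem_filter.1 hm).2.symm, rfl⟩)
  have hdisj : Disjoint {m : FYExponent n | m.1.degree < i.1.degree}
      {m | m.1.degree = i.1.degree} := by
    rw [Set.disjoint_left]
    intro m h h'
    exact (ne_of_lt (show m.1.degree < i.1.degree from h)) h'
  have h4 := Submodule.disjoint_def.1
    ((linearIndependent_fyEval n).disjoint_span_image hdisj) _ h2 h3
  have h5 := linearIndependent_iff'.1 (linearIndependent_fyEval n) t _ h4 i
    (Finset.mem_filter.2 ⟨hi, rfl⟩)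
  exact_mod_cast h5

/-! ### Orbits of exponent vectors under permutations -/

/-- The multiset of sizes of an exponent vector: the exponent of `l` is `∑_{|S| = l} m(S)`. -/
def sizeExponent {n : ℕ} (m : NonemptySubset n →₀ ℕ) : ℕ →₀ ℕ :=
  m.mapDomain fun S => S.1.card

/-- The exponent vectors of the monomials `∏ z_{s_i}^{p_i}` with `p_i < s_i - s_{i-1}`. -/
def IsFYSizeExponent (n : ℕ) (t : ℕ →₀ ℕ) : Prop :=
  ∀ s ∈ t.support, s ≤ n ∧ t s < s ∧ ∀ s' ∈ t.support, s' < s → t s + s' < s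

theorem IsFYExponent.subset_or_subset {n : ℕ} {m : NonemptySubset n →₀ ℕ}
    (h : IsFYExponent ∅ m) {S T : NonemptySubset n} (hS : S ∈ m.support) (hT : T ∈ m.support) :
    S.1 ⊆ T.1 ∨ T.1 ⊆ S.1 := by
  rcases (h S hS).2.2 T hT with rfl | h1 | h1
  · exact Or.inl subset_rfl
  · exact Or.inr h1.1.subset
  · exact Or.inl h1.subset

theorem eq_of_card_eq_of_subset_or {n : ℕ} {S T : NonemptySubset n}
    (h : S.1 ⊆ T.1 ∨ T.1 ⊆ S.1) (hc : S.1.card = T.1.card) : S = T := by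
  apply Subtype.ext
  rcases h with h | h
  · exact Finset.eq_of_subset_of_card_le h hc.ge
  · exact (Finset.eq_of_subset_of_card_le h hc.le).symm

theorem sizeExponent_apply_card {n : ℕ} {m : NonemptySubset n →₀ ℕ}
    (h : ∀ S ∈ m.support, ∀ T ∈ m.support, S.1 ⊆ T.1 ∨ T.1 ⊆ S.1) {S : NonemptySubset n}
    (hS : S ∈ m.support) : sizeExponent m S.1.card = m S := by
  rw [sizeExponent]
  refine Finsupp.mapDomain_apply' (m.support : Set (NonemptySubset n))
    (f := fun S : NonemptySubset n => S.1.card) m le_rfl ?_ hS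
  intro S hS T hT hc
  exact eq_of_card_eq_of_subset_or (h S hS T hT) hc

theorem mem_support_mapDomain_nat {α β : Type*} {f : α → β} {m : α →₀ ℕ} {b : β} :
    b ∈ (m.mapDomain f).support ↔ ∃ a ∈ m.support, f a = b := by
  classical
  rw [Finsupp.mem_support_iff, Finsupp.mapDomain, Finsupp.sum, Finsupp.finsetSum_apply, ne_eq,
    Finset.sum_eq_zero_iff]
  simp only [not_forall, exists_prop, Finsupp.single_apply]
  refine exists_congr fun a => and_congr_right fun ha => ?_
  have := Finsupp.mem_support_iff.1 ha
  split_ifs with h <;> simp [h, this]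

theorem mem_support_sizeExponent {n : ℕ} {m : NonemptySubset n →₀ ℕ} {l : ℕ} :
    l ∈ (sizeExponent m).support ↔ ∃ S ∈ m.support, S.1.card = l :=
  mem_support_mapDomain_nat

/-- Beyond the chain condition, being FY depends only on the sizes. This is what makes the size
exponent a complete invariant of orbits. -/
theorem isFYExponent_iff {n : ℕ} {m : NonemptySubset n →₀ ℕ} :
    IsFYExponent ∅ m ↔ (∀ S ∈ m.support, ∀ T ∈ m.support, S.1 ⊆ T.1 ∨ T.1 ⊆ S.1) ∧
      IsFYSizeExponent n (sizeExponent m) := by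
  constructor
  · intro h
    have hch : ∀ S ∈ m.support, ∀ T ∈ m.support, S.1 ⊆ T.1 ∨ T.1 ⊆ S.1 :=
      fun S hS T hT => h.subset_or_subset hS hT
    refine ⟨hch, fun s hs => ?_⟩
    obtain ⟨S, hS, rfl⟩ := mem_support_sizeExponent.1 hs
    rw [sizeExponent_apply_card hch hS]
    refine ⟨(Finset.card_le_univ S.1).trans_eq (Fintype.card_fin n), by simpa using (h S hS).2.1,
      fun s' hs' hlt => ?_⟩
    obtain ⟨T, hT, rfl⟩ := mem_support_sizeExponent.1 hs'
    rcases (h S hS).2.2 T hT with rfl | h1 | h1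
    · exact absurd hlt (lt_irrefl _)
    · exact h1.2
    · exact absurd (Finset.card_lt_card h1) (by omega)
  · rintro ⟨hch, h⟩ S hS
    have h1 := h _ (mem_support_sizeExponent.2 ⟨S, hS, rfl⟩)
    rw [sizeExponent_apply_card hch hS] at h1
    refine ⟨Finset.empty_subset _, by simpa using h1.2.1, fun T hT => ?_⟩
    by_cases hTS : T = S
    · exact Or.inl hTS
    · refine Or.inr ?_
      rcases hch S hS T hT with h2 | h2
      · exact Or.inr (Finset.ssubset_iff_subset_ne.2 ⟨h2, fun h' => hTS (Subtype.ext h'.symm)⟩)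
      · have h3 : T.1 ⊂ S.1 :=
          Finset.ssubset_iff_subset_ne.2 ⟨h2, fun h' => hTS (Subtype.ext h')⟩
        exact Or.inl ⟨h3, h1.2.2 _ (mem_support_sizeExponent.2 ⟨T, hT, rfl⟩)
          (Finset.card_lt_card h3)⟩

theorem degree_sizeExponent {n : ℕ} (m : NonemptySubset n →₀ ℕ) :
    (sizeExponent m).degree = m.degree :=
  Finsupp.degree_mapDomain _ _

/-- The action of permutations on exponent vectors. -/
def permExponent {n : ℕ} (σ : Equiv.Perm (Fin n)) (m : NonemptySubset n →₀ ℕ) :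
    NonemptySubset n →₀ ℕ :=
  m.mapDomain (permSubset σ)

theorem card_permSubset {n : ℕ} (σ : Equiv.Perm (Fin n)) (S : NonemptySubset n) :
    (permSubset σ S).1.card = S.1.card :=
  Finset.card_map _

theorem permSubset_injective {n : ℕ} (σ : Equiv.Perm (Fin n)) :
    Function.Injective (permSubset σ) := fun _ _ h =>
  Subtype.ext (Finset.map_injective σ.toEmbedding (congrArg Subtype.val h))

theorem sizeExponent_permExponent {n : ℕ} (σ : Equiv.Perm (Fin n)) (m : NonemptySubset n →₀ ℕ) :
    sizeExponent (permExponent σ m) = sizeExponent m := by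
  rw [sizeExponent, permExponent, ← Finsupp.mapDomain_comp, sizeExponent]
  congr 1
  ext S
  exact card_permSubset σ S

theorem mem_support_permExponent {n : ℕ} {σ : Equiv.Perm (Fin n)} {m : NonemptySubset n →₀ ℕ}
    {S : NonemptySubset n} :
    S ∈ (permExponent σ m).support ↔ ∃ T ∈ m.support, permSubset σ T = S :=
  mem_support_mapDomain_nat

theorem IsFYExponent.perm {n : ℕ} {m : NonemptySubset n →₀ ℕ} (h : IsFYExponent ∅ m)
    (σ : Equiv.Perm (Fin n)) : IsFYExponent ∅ (permExponent σ m) := by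
  rw [isFYExponent_iff] at h ⊢
  rw [sizeExponent_permExponent]
  refine ⟨fun S hS T hT => ?_, h.2⟩
  obtain ⟨S, hS', rfl⟩ := mem_support_permExponent.1 hS
  obtain ⟨T, hT', rfl⟩ := mem_support_permExponent.1 hT
  simpa [permSubset] using h.1 S hS' T hT'

theorem chowPerm_chowMonomial {n : ℕ} (σ : Equiv.Perm (Fin n)) (m : NonemptySubset n →₀ ℕ) :
    chowPerm σ (chowMonomial m) = chowMonomial (permExponent σ m) := by
  rw [chowMonomial, chowPerm, Ideal.quotientMap_mk]
  simp only [AlgHom.toRingHom_eq_coe, RingHom.coe_coe, MvPolynomial.rename_monomial]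
  rfl

/-- A chain of subsets consists of initial segments for some ordering of the ground set. -/
theorem exists_perm_eq_permPrefix {n : ℕ} (s : Finset (NonemptySubset n))
    (hs : ∀ S ∈ s, ∀ T ∈ s, S.1 ⊆ T.1 ∨ T.1 ⊆ S.1) :
    ∃ σ : Equiv.Perm (Fin n), ∀ S ∈ s, S.1 = permPrefix σ S.1.card := by
  classical
  -- `ρ e` counts the members of the chain that omit `e`. Each member is a sublevel set of `ρ`, so
  -- sorting by `ρ` makes it an initial segment.
  set ρ : Fin n → ℕ := fun e => (s.filter fun T => e ∉ T.1).card with hρ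
  refine ⟨(Tuple.sort ρ)⁻¹, fun S hS => ?_⟩
  have hmem : ∀ e, e ∈ S.1 ↔ ρ e ≤ (s.filter fun T => T.1 ⊂ S.1).card := by
    intro e
    constructor
    · intro he
      refine Finset.card_le_card fun T hT => ?_
      rw [Finset.mem_filter] at hT ⊢
      have h1 : ¬ S.1 ⊆ T.1 := fun h => hT.2 (h he)
      exact ⟨hT.1, ((hs S hS T hT.1).resolve_left h1), h1⟩
    · intro hle
      by_contra he
      refine absurd hle (not_le.2 (Finset.card_lt_card ?_))
      refine Finset.ssubset_iff_of_subset (fun T hT => ?_) |>.2 ⟨S, ?_, ?_⟩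
      · rw [Finset.mem_filter] at hT ⊢
        exact ⟨hT.1, fun h => he (hT.2.1 h)⟩
      · simpa [hS] using he
      · simp
  have hcard : (Finset.univ.filter fun i => (ρ ∘ Tuple.sort ρ) i ≤
      (s.filter fun T => T.1 ⊂ S.1).card).card = S.1.card := by
    rw [← Finset.card_map (Tuple.sort ρ).toEmbedding]
    congr 1
    ext e
    rw [Finset.mem_map_equiv]
    simp [hmem]
  ext e
  rw [mem_permPrefix, hmem, ← hcard, Tuple.lt_card_le_iff_apply_le_of_monotone
    (Tuple.monotone_sort ρ)]
  simp

theorem injOn_card_permPrefix {n : ℕ} (σ : Equiv.Perm (Fin n)) :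
    Set.InjOn (fun S : NonemptySubset n => S.1.card) {S | S.1 = permPrefix σ S.1.card} := by
  intro S hS T hT hc
  rw [Set.mem_ofPred_eq] at hS hT
  apply Subtype.ext
  rw [hS, hT, show S.1.card = T.1.card from hc]

/-- Both chains consist of initial segments of some orderings `σ` and `τ`. The permutation carrying
one ordering to the other matches initial segments of equal size. -/
theorem exists_permExponent_eq {n : ℕ} {m m' : NonemptySubset n →₀ ℕ} (h : IsFYExponent ∅ m)
    (h' : IsFYExponent ∅ m') (ht : sizeExponent m = sizeExponent m') :
    ∃ σ : Equiv.Perm (Fin n), permExponent σ m = m' := by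
  obtain ⟨σ, hσ⟩ := exists_perm_eq_permPrefix m.support (isFYExponent_iff.1 h).1
  obtain ⟨τ, hτ⟩ := exists_perm_eq_permPrefix m'.support (isFYExponent_iff.1 h').1
  refine ⟨σ.trans τ.symm, ?_⟩
  refine Finsupp.mapDomain_injOn _ (injOn_card_permPrefix τ) ?_ hτ
    ((sizeExponent_permExponent _ m).trans ht)
  intro S hS
  obtain ⟨T, hT, rfl⟩ := mem_support_permExponent.1 hS
  rw [Set.mem_ofPred_eq, card_permSubset]
  ext e
  have h1 : e ∈ (permSubset (σ.trans τ.symm) T).1 ↔ σ.symm (τ e) ∈ T.1 := by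
    rw [permSubset, Finset.mem_map_equiv]
    rfl
  rw [h1, hσ T hT, mem_permPrefix, mem_permPrefix, Equiv.apply_symm_apply, ← hσ T hT]

theorem exists_isFYExponent_sizeExponent_eq {n : ℕ} {t : ℕ →₀ ℕ} (ht : IsFYSizeExponent n t) :
    ∃ m : NonemptySubset n →₀ ℕ, IsFYExponent ∅ m ∧ sizeExponent m = t := by
  classical
  -- The exponents are placed on the initial segments of the natural order.
  set m : NonemptySubset n →₀ ℕ := Finsupp.equivFunOnFinite.symm
    (fun S => if S.1 = permPrefix 1 S.1.card then t S.1.card else 0) with hm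
  have hmS : ∀ S, m S = if S.1 = permPrefix 1 S.1.card then t S.1.card else 0 := fun S => rfl
  have hsub : (m.support : Set (NonemptySubset n)) ⊆ {S | S.1 = permPrefix 1 S.1.card} := by
    intro S hS
    rw [Finset.mem_coe, Finsupp.mem_support_iff, hmS] at hS
    by_contra h
    exact hS (if_neg h)
  have hsize : sizeExponent m = t := by
    ext k
    by_cases hk : k ∈ Finset.Icc 1 n
    · rw [Finset.mem_Icc] at hk
      have hc := card_permPrefix (1 : Equiv.Perm (Fin n)) hk.2
      have hne : (permPrefix (1 : Equiv.Perm (Fin n)) k).Nonempty := by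
        rw [← Finset.card_pos]; omega
      have h1 := Finsupp.mapDomain_apply' _ m hsub (injOn_card_permPrefix 1)
        (a := ⟨permPrefix 1 k, hne⟩) (by rw [Set.mem_ofPred_eq, hc])
      rw [hmS] at h1
      simpa only [hc, if_true, sizeExponent] using h1
    · have h1 : t k = 0 := by
        by_contra h
        have := ht k (Finsupp.mem_support_iff.2 h)
        exact hk (Finset.mem_Icc.2 (by omega))
      rw [h1, sizeExponent, Finsupp.mapDomain_of_notMem_range]
      rintro ⟨S, hS⟩
      refine hk (Finset.mem_Icc.2 ⟨?_, ?_⟩)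
      · rw [← hS]; exact Finset.card_pos.2 S.2
      · rw [← hS]; exact (Finset.card_le_univ S.1).trans_eq (Fintype.card_fin n)
  refine ⟨m, isFYExponent_iff.2 ⟨fun S hS T hT => ?_, hsize ▸ ht⟩, hsize⟩
  rw [show S.1 = permPrefix 1 S.1.card from hsub hS, show T.1 = permPrefix 1 T.1.card from hsub hT]
  exact (le_total S.1.card T.1.card).imp (permPrefix_mono 1) (permPrefix_mono 1)

/-! ### Orbit sums and the invariant ring -/

/-- The set of Feichtner–Yuzvinsky exponent vectors. -/
def fyFinset (n : ℕ) : Finset (NonemptySubset n →₀ ℕ) :=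
  (Set.finite_coe_iff.1 (finite_fyExponent n)).toFinset

theorem mem_fyFinset {n : ℕ} {m : NonemptySubset n →₀ ℕ} :
    m ∈ fyFinset n ↔ IsFYExponent ∅ m :=
  Set.Finite.mem_toFinset _

/-- The monomial `∏ z_l^{t(l)}`. -/
def chowZMonomial (n : ℕ) (t : ℕ →₀ ℕ) : FreeChowRing n := t.prod fun l p => chowZ n l ^ p

theorem sum_pow_of_pairwise_mul_eq_zero {R ι : Type*} [CommRing R] (s : Finset ι) (a : ι → R)
    (h : ∀ i ∈ s, ∀ j ∈ s, i ≠ j → a i * a j = 0) (k : ℕ) :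
    (∑ i ∈ s, a i) ^ (k + 1) = ∑ i ∈ s, a i ^ (k + 1) := by
  induction k with
  | zero => simp
  | succ k ih =>
    rw [pow_succ, ih, Finset.sum_mul]
    refine Finset.sum_congr rfl fun i hi => ?_
    rw [Finset.mul_sum, Finset.sum_eq_single_of_mem i hi, ← pow_succ]
    intro j hj hji
    rw [pow_succ, mul_assoc, h i hi j hj hji.symm, mul_zero]

/-- Distinct sets of equal size are incomparable, so all cross terms vanish. -/
theorem chowZ_pow {n l p : ℕ} (hp : p ≠ 0) :
    chowZ n l ^ p = ∑ S ∈ Finset.univ.filter (fun S : NonemptySubset n => S.1.card = l),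
      chowX S ^ p := by
  obtain ⟨k, rfl⟩ := Nat.exists_eq_succ_of_ne_zero hp
  refine sum_pow_of_pairwise_mul_eq_zero _ _ (fun S hS T hT hne => ?_) k
  rw [Finset.mem_filter] at hS hT
  have hc : S.1.card = T.1.card := hS.2.trans hT.2.symm
  exact chowX_mul_chowX_eq_zero (fun h => hne (eq_of_card_eq_of_subset_or (Or.inl h) hc))
    fun h => hne (eq_of_card_eq_of_subset_or (Or.inr h) hc)

/-- Expanding the product chooses one set for each size in the support of `t`. Choices that are not
chains contribute zero, and the others give each FY monomial of size exponent `t` exactly once. -/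
theorem chowZMonomial_eq_sum {n : ℕ} {t : ℕ →₀ ℕ} (ht : IsFYSizeExponent n t) :
    chowZMonomial n t = ∑ m ∈ (fyFinset n).filter (fun m => sizeExponent m = t),
      chowMonomial m := by
  classical
  set E : (t.support → NonemptySubset n) → (NonemptySubset n →₀ ℕ) :=
    fun g => ∑ i, Finsupp.single (g i) (t i) with hE
  have h1 : chowZMonomial n t = ∑ g ∈ Fintype.piFinset (fun i : t.support =>
      Finset.univ.filter (fun S : NonemptySubset n => S.1.card = (i : ℕ))), chowMonomial (E g) := by
    rw [chowZMonomial, Finsupp.prod, ← Finset.prod_coe_sort]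
    rw [Finset.prod_congr rfl fun (i : t.support) _ =>
      chowZ_pow (n := n) (l := i) (Finsupp.mem_support_iff.1 i.2), Finset.prod_univ_sum]
    refine Finset.sum_congr rfl fun g _ => ?_
    simp only [← chowMonomial_single]
    have h2 : ∀ s : Finset t.support, ∏ i ∈ s, chowMonomial (Finsupp.single (g i) (t i))
        = chowMonomial (∑ i ∈ s, Finsupp.single (g i) (t i)) := by
      intro s
      induction s using Finset.induction_on with
      | empty => simp [chowMonomial]
      | insert i s hi ih => rw [Finset.prod_insert hi, Finset.sum_insert hi, chowMonomial_add, ih]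
    exact h2 _
  have hsupp : ∀ g, ∀ S, S ∈ (E g).support ↔ ∃ i, g i = S := by
    intro g S
    rw [Finsupp.mem_support_iff, hE]
    simp only [Finsupp.coe_finsetSum, Finset.sum_apply, Finsupp.single_apply, ne_eq,
      Finset.sum_eq_zero_iff, Finset.mem_univ, true_imp_iff, not_forall]
    refine exists_congr fun i => ?_
    have := Finsupp.mem_support_iff.1 i.2
    split_ifs with h <;> simp [h, this]
  have hsize : ∀ g : t.support → NonemptySubset n, (∀ i, (g i).1.card = i) →
      sizeExponent (E g) = t := by
    intro g hg
    rw [sizeExponent, hE]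
    simp only [Finsupp.mapDomain_finsetSum, Finsupp.mapDomain_single, hg]
    rw [Finset.sum_coe_sort t.support (fun i => Finsupp.single i (t i))]
    exact t.sum_single
  have hpi : ∀ g, g ∈ Fintype.piFinset (fun i : t.support =>
      Finset.univ.filter (fun S : NonemptySubset n => S.1.card = (i : ℕ))) ↔
        ∀ i, (g i).1.card = i := by
    intro g
    simp [Fintype.mem_piFinset]
  rw [h1, ← Finset.sum_filter_of_ne (p := fun g => IsFYExponent ∅ (E g))]
  · refine Finset.sum_nbij E ?_ ?_ ?_ fun _ _ => rfl
    · intro g hg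
      rw [Finset.mem_filter, hpi] at hg
      exact Finset.mem_filter.2 ⟨mem_fyFinset.2 hg.2, hsize g hg.1⟩
    · intro g hg g' hg' heq
      rw [Finset.mem_coe, Finset.mem_filter, hpi] at hg hg'
      funext i
      have h2 := (hsupp g (g i)).2 ⟨i, rfl⟩
      rw [heq, hsupp] at h2
      obtain ⟨j, hj⟩ := h2
      have h3 : (i : ℕ) = j := by rw [← hg.1 i, ← hj, hg'.1 j]
      rw [← hj, Subtype.ext h3]
    · intro m hm
      rw [Finset.mem_coe, Finset.mem_filter, mem_fyFinset] at hm
      obtain ⟨hm, rfl⟩ := hm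
      have h2 : ∀ i : (sizeExponent m).support, ∃ S ∈ m.support, S.1.card = i :=
        fun i => mem_support_sizeExponent.1 i.2
      choose g hg hgc using h2
      have hEg : E g = m := by
        refine Finsupp.mapDomain_injOn (m.support : Set (NonemptySubset n)) ?_ ?_ ?_ (hsize g hgc)
        · intro S hS T hT hc
          exact eq_of_card_eq_of_subset_or (hm.subset_or_subset hS hT) hc
        · intro S hS
          obtain ⟨i, rfl⟩ := (hsupp g S).1 hS
          exact hg i
        · exact Set.Subset.refl _
      refine ⟨g, ?_, hEg⟩
      rw [Finset.mem_coe, Finset.mem_filter, hpi, hEg]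
      exact ⟨hgc, hm⟩
  · intro g hg hne
    rw [isFYExponent_iff, hsize g ((hpi g).1 hg)]
    refine ⟨fun S hS T hT => ?_, ht⟩
    by_contra! h
    exact hne (chowMonomial_eq_zero hS hT h.1 h.2)

/-- The Feichtner–Yuzvinsky basis of the Chow ring. -/
def fyBasis (n : ℕ) : Module.Basis (FYExponent n) ℤ (FreeChowRing n) :=
  Module.Basis.mk (linearIndependent_chowMonomial n) (by
    rintro f -
    obtain ⟨p, rfl⟩ := Ideal.Quotient.mk_surjective f
    rw [mk_eq_sum_chowMonomial]
    refine Submodule.sum_mem _ fun m _ => Submodule.smul_mem _ _ ?_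
    refine Submodule.span_mono ?_ (chowMonomial_mem_fySpan m)
    rintro _ ⟨m', h, -, rfl⟩
    exact ⟨⟨m', h⟩, rfl⟩)

theorem fyBasis_apply {n : ℕ} (m : FYExponent n) : fyBasis n m = chowMonomial m.1 := by
  rw [fyBasis, Module.Basis.mk_apply]

theorem fyBasis_coord_chowPerm {n : ℕ} (σ : Equiv.Perm (Fin n)) (m : FYExponent n)
    (f : FreeChowRing n) :
    (fyBasis n).coord ⟨permExponent σ m.1, m.2.perm σ⟩ (chowPerm σ f) = (fyBasis n).coord m f := by
  classical
  have h : (fyBasis n).coord ⟨permExponent σ m.1, m.2.perm σ⟩ ∘ₗ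
      (chowPerm σ).toIntAlgHom.toLinearMap = (fyBasis n).coord m := by
    refine (fyBasis n).ext fun m' => ?_
    have h1 : (chowPerm σ).toIntAlgHom.toLinearMap (fyBasis n m') =
        fyBasis n ⟨permExponent σ m'.1, m'.2.perm σ⟩ := by
      rw [fyBasis_apply, fyBasis_apply]
      exact chowPerm_chowMonomial σ m'.1
    rw [LinearMap.comp_apply, h1, Module.Basis.coord_apply, Module.Basis.coord_apply,
      Module.Basis.repr_self, Module.Basis.repr_self, Finsupp.single_apply, Finsupp.single_apply]
    congr 1
    rw [Subtype.mk.injEq, eq_iff_iff, Subtype.ext_iff]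
    exact (Finsupp.mapDomain_injective (permSubset_injective σ)).eq_iff
  exact LinearMap.congr_fun h f

/-- The FY coordinates of an invariant are constant on orbits, so it is a combination of orbit sums.
The predicate `P` allows one argument to serve the whole ring and a single degree. -/
theorem mem_span_chowZMonomial_of_invariant {n : ℕ} {f : FreeChowRing n}
    (hf : f ∈ chowInvariants n) (P : ℕ → Prop)
    (hP : ∀ m : FYExponent n, (fyBasis n).coord m f ≠ 0 → P m.1.degree) :
    f ∈ Submodule.span ℤ {g | ∃ t, IsFYSizeExponent n t ∧ P t.degree ∧ chowZMonomial n t = g} := by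
  classical
  set c : (NonemptySubset n →₀ ℕ) → ℤ :=
    fun m => if h : IsFYExponent ∅ m then (fyBasis n).coord ⟨m, h⟩ f else 0 with hc
  have hcm : ∀ m : FYExponent n, c m.1 = (fyBasis n).coord m f := fun m => dif_pos m.2
  have hconst : ∀ m m', IsFYExponent ∅ m → IsFYExponent ∅ m' →
      sizeExponent m = sizeExponent m' → c m = c m' := by
    intro m m' h h' ht
    obtain ⟨σ, rfl⟩ := exists_permExponent_eq h h' ht
    rw [hcm ⟨m, h⟩, hcm ⟨_, h'⟩, ← fyBasis_coord_chowPerm σ ⟨m, h⟩ f, hf σ]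
  have hsum : f = ∑ m ∈ fyFinset n, c m • chowMonomial m := by
    have := Fintype.ofFinite (FYExponent n)
    conv_lhs => rw [← (fyBasis n).sum_repr f]
    symm
    refine Finset.sum_bij' (fun m hm => ⟨m, mem_fyFinset.1 hm⟩) (fun m _ => m.1) ?_ ?_ ?_ ?_ ?_
    · exact fun _ _ => Finset.mem_univ _
    · exact fun m _ => mem_fyFinset.2 m.2
    · exact fun _ _ => rfl
    · exact fun _ _ => rfl
    · intro m hm
      rw [fyBasis_apply, hcm ⟨m, mem_fyFinset.1 hm⟩, Module.Basis.coord_apply]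
  rw [hsum, ← Finset.sum_fiberwise_of_maps_to (t := (fyFinset n).image sizeExponent)
    fun m hm => Finset.mem_image_of_mem _ hm]
  refine Submodule.sum_mem _ fun t ht => ?_
  obtain ⟨m₀, hm₀, rfl⟩ := Finset.mem_image.1 ht
  rw [mem_fyFinset] at hm₀
  have h1 : ∑ m ∈ (fyFinset n).filter (fun m => sizeExponent m = sizeExponent m₀),
      c m • chowMonomial m = c m₀ • chowZMonomial n (sizeExponent m₀) := by
    rw [chowZMonomial_eq_sum (isFYExponent_iff.1 hm₀).2, Finset.smul_sum]
    refine Finset.sum_congr rfl fun m hm => ?_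
    rw [Finset.mem_filter, mem_fyFinset] at hm
    rw [hconst m m₀ hm.1 hm₀ hm.2]
  rw [h1]
  by_cases h0 : c m₀ = 0
  · rw [h0, zero_smul]
    exact zero_mem _
  · refine Submodule.smul_mem _ _ (Submodule.subset_span ⟨_, (isFYExponent_iff.1 hm₀).2, ?_, rfl⟩)
    rw [degree_sizeExponent]
    exact hP ⟨m₀, hm₀⟩ (by rwa [← hcm])

theorem degree_eq_of_coord_ne_zero {n d : ℕ} {f : FreeChowRing n} (hf : f ∈ chowDegree n d)
    (m : FYExponent n) (hm : (fyBasis n).coord m f ≠ 0) : m.1.degree = d := by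
  have h1 : fySpan n d ≤ Submodule.span ℤ (fyBasis n '' {m | m.1.degree = d}) := by
    refine Submodule.span_mono ?_
    rintro _ ⟨m, h, h', rfl⟩
    exact ⟨⟨m, h⟩, h', fyBasis_apply _⟩
  rw [chowDegree_eq_fySpan] at hf
  have h2 := (fyBasis n).mem_span_image.1 (h1 hf)
  exact h2 (Finsupp.mem_support_iff.2 hm)

theorem chowZMonomial_mem_chowDegree {n : ℕ} {t : ℕ →₀ ℕ} (ht : IsFYSizeExponent n t) :
    chowZMonomial n t ∈ chowDegree n t.degree := by
  rw [chowDegree_eq_fySpan, chowZMonomial_eq_sum ht]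
  refine Submodule.sum_mem _ fun m hm => Submodule.subset_span ?_
  rw [Finset.mem_filter, mem_fyFinset] at hm
  exact ⟨m, hm.1, by rw [← degree_sizeExponent, hm.2], rfl⟩

/-- Different orbits are disjoint, so the coordinates at one representative of each orbit form a
dual family. -/
theorem linearIndependent_chowZMonomial (n : ℕ) :
    LinearIndependent ℤ (fun t : {t : ℕ →₀ ℕ // IsFYSizeExponent n t} => chowZMonomial n t.1) := by
  classical
  choose m hm hmt using fun t : {t : ℕ →₀ ℕ // IsFYSizeExponent n t} =>
    exists_isFYExponent_sizeExponent_eq t.2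
  have key : ∀ t t' : {t : ℕ →₀ ℕ // IsFYSizeExponent n t},
      (fyBasis n).coord ⟨m t, hm t⟩ (chowZMonomial n t'.1) = if t = t' then 1 else 0 := by
    intro t t'
    rw [chowZMonomial_eq_sum t'.2, map_sum]
    have h1 : ∀ m' ∈ (fyFinset n).filter (fun m => sizeExponent m = t'.1),
        (fyBasis n).coord ⟨m t, hm t⟩ (chowMonomial m') = if m t = m' then 1 else 0 := by
      intro m' hm'
      rw [Finset.mem_filter, mem_fyFinset] at hm'
      rw [← fyBasis_apply ⟨m', hm'.1⟩, Module.Basis.coord_apply, Module.Basis.repr_self,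
        Finsupp.single_apply]
      simp only [Subtype.mk.injEq, eq_comm]
    rw [Finset.sum_congr rfl h1, Finset.sum_ite_eq]
    congr 1
    rw [Finset.mem_filter, mem_fyFinset, hmt, Subtype.ext_iff, eq_iff_iff]
    exact and_iff_right (hm t)
  refine LinearIndependent.of_pairwise_dual_eq_zero_one _
    (fun t => (fyBasis n).coord ⟨m t, hm t⟩) (fun t t' h => ?_) fun t => ?_
  · exact (key t t').trans (if_neg h)
  · exact (key t t).trans (if_pos rfl)

/-! ### The rank-nullity ring of a uniform matroid -/

theorem uniformMatroid_indep {r n : ℕ} {I : Set (Fin n)} :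
    (uniformMatroid r n).Indep I ↔ I.ncard ≤ r := by
  simp [uniformMatroid]

theorem matroidRank_uniformMatroid (r : ℕ) {n : ℕ} (S : Finset (Fin n)) :
    matroidRank (uniformMatroid r n) S = min S.card r := by
  have h : (uniformMatroid r n).eRk (S : Set (Fin n)) = (min S.card r : ℕ) := by
    apply le_antisymm
    · rw [Matroid.eRk_le_iff]
      intro I hI hind
      rw [uniformMatroid_indep] at hind
      have h1 := Set.ncard_le_ncard hI S.finite_toSet
      rw [Set.ncard_coe_finset] at h1
      rw [← (S.finite_toSet.subset hI).cast_ncard_eq]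
      exact_mod_cast le_min h1 hind
    · rw [Matroid.le_eRk_iff]
      obtain ⟨T, hT, hc⟩ := Finset.exists_subset_card_eq (min_le_left S.card r)
      refine ⟨T, by exact_mod_cast hT, ?_, ?_⟩
      · rw [uniformMatroid_indep, Set.ncard_coe_finset, hc]
        exact min_le_right _ _
      · rw [Set.encard_coe_eq_coe_finsetCard, hc]
  rw [matroidRank, h, ENat.toNat_natCast]

/-- Rank plus nullity is size, and the hypothesis says that sets of size `i + j` do have rank `i`.
-/
theorem rankNullityGen_uniformMatroid (r : ℕ) {n i j : ℕ} (h : min (i + j) r = i) :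
    rankNullityGen (uniformMatroid r n) i j = chowZ n (i + j) := by
  rw [rankNullityGen, chowZ]
  congr 1
  ext S
  simp only [Finset.mem_filter, Finset.mem_univ, true_and, matroidNullity,
    matroidRank_uniformMatroid]
  constructor
  · rintro ⟨h1, h2⟩
    have := min_le_left S.1.card r
    omega
  · intro h1
    rw [h1, h]
    omega

theorem rankNullityGen_uniformMatroid_eq_zero (r : ℕ) {n i j : ℕ} (h : min (i + j) r ≠ i) :
    rankNullityGen (uniformMatroid r n) i j = 0 := by
  rw [rankNullityGen, Finset.filter_false_of_mem, Finset.sum_empty]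
  rintro S - ⟨h1, h2⟩
  rw [matroidNullity, matroidRank_uniformMatroid] at *
  have h3 := min_le_left S.1.card r
  have h4 : S.1.card = i + j := by omega
  rw [h4] at h1
  exact h h1

theorem chowZ_mem_rankNullityRing (r n l : ℕ) :
    chowZ n l ∈ rankNullityRing (uniformMatroid r n) := by
  by_cases hl : l ≤ n
  · have h1 := min_le_left l r
    have h2 : min l r + (l - min l r) = l := by omega
    refine Algebra.subset_adjoin ⟨min l r, l - min l r, by omega, by omega, ?_⟩
    rw [rankNullityGen_uniformMatroid r (by rw [h2]), h2]
  · have h0 : chowZ n l = 0 := by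
      rw [chowZ, Finset.filter_false_of_mem, Finset.sum_empty]
      rintro S - h
      exact hl (h ▸ (Finset.card_le_univ S.1).trans_eq (Fintype.card_fin n))
    rw [h0]
    exact zero_mem _

theorem chowZMonomial_mem_rankNullityRing (r n : ℕ) (t : ℕ →₀ ℕ) :
    chowZMonomial n t ∈ rankNullityRing (uniformMatroid r n) :=
  prod_mem fun l _ => pow_mem (chowZ_mem_rankNullityRing r n l) _

theorem chowPerm_chowX {n : ℕ} (σ : Equiv.Perm (Fin n)) (S : NonemptySubset n) :
    chowPerm σ (chowX S) = chowX (permSubset σ S) := by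
  rw [chowX, chowPerm, Ideal.quotientMap_mk]
  simp only [AlgHom.toRingHom_eq_coe, RingHom.coe_coe, MvPolynomial.rename_X]
  rfl

theorem chowZ_mem_chowInvariants (n l : ℕ) : chowZ n l ∈ chowInvariants n := by
  intro σ
  rw [chowZ, map_sum]
  refine Finset.sum_nbij (permSubset σ) ?_ (permSubset_injective σ).injOn ?_
    fun S _ => chowPerm_chowX σ S
  · intro S hS
    rw [Finset.mem_filter] at hS ⊢
    exact ⟨Finset.mem_univ _, (card_permSubset σ S).trans hS.2⟩
  · intro S hS
    obtain ⟨T, rfl⟩ := Finite.surjective_of_injective (permSubset_injective σ) S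
    rw [Finset.mem_coe, Finset.mem_filter, card_permSubset] at hS
    exact ⟨T, by simpa using hS.2, rfl⟩

theorem rankNullityRing_subset_chowInvariants (r n : ℕ) {f : FreeChowRing n}
    (hf : f ∈ rankNullityRing (uniformMatroid r n)) : f ∈ chowInvariants n := by
  intro σ
  induction hf using Algebra.adjoin_induction with
  | mem x hx =>
    obtain ⟨i, j, -, -, rfl⟩ := hx
    by_cases h : min (i + j) r = i
    · rw [rankNullityGen_uniformMatroid r h]
      exact chowZ_mem_chowInvariants n _ σ
    · rw [rankNullityGen_uniformMatroid_eq_zero r h, map_zero]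
  | algebraMap c => simp
  | add x y _ _ hx hy => rw [map_add, hx, hy]
  | mul x y _ _ hx hy => rw [map_mul, hx, hy]

theorem rankNullityRing_eq_chowInvariants (r n : ℕ) :
    (rankNullityRing (uniformMatroid r n) : Set (FreeChowRing n)) = chowInvariants n := by
  refine Set.Subset.antisymm (fun f hf => rankNullityRing_subset_chowInvariants r n hf)
    fun f hf => ?_
  have h1 := mem_span_chowZMonomial_of_invariant hf (fun _ => True) fun _ _ => trivial
  refine (Submodule.span_le (p := Subalgebra.toSubmodule
    (rankNullityRing (uniformMatroid r n)))).2 ?_ h1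
  rintro _ ⟨t, -, -, rfl⟩
  exact chowZMonomial_mem_rankNullityRing r n t

theorem rankNullityDegree_eq_span (r n d : ℕ) :
    rankNullityDegree (uniformMatroid r n) d = Submodule.span ℤ
      {g | ∃ t, IsFYSizeExponent n t ∧ t.degree = d ∧ chowZMonomial n t = g} := by
  apply le_antisymm
  · rintro f ⟨h1, h2⟩
    exact mem_span_chowZMonomial_of_invariant (rankNullityRing_subset_chowInvariants r n h1)
      (· = d) (degree_eq_of_coord_ne_zero h2)
  · rw [Submodule.span_le]
    rintro _ ⟨t, ht, rfl, rfl⟩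
    exact ⟨chowZMonomial_mem_rankNullityRing r n t, chowZMonomial_mem_chowDegree ht⟩

/-! ### Basis monomials as exponent vectors -/

theorem basisMonomials_eq (n d : ℕ) :
    basisMonomials n d =
      {g | ∃ t, IsFYSizeExponent n t ∧ t.degree = d ∧ chowZMonomial n t = g} := by
  classical
  ext f
  constructor
  · rintro ⟨l, s, p, h0, hn, hp, hd, rfl⟩
    have hmono : StrictMono s := Fin.strictMono_iff_lt_succ.2 fun i => by
      have := (hp i).2
      omega
    have hinj : Function.Injective fun i : Fin l => s i.succ :=
      fun i j h => Fin.succ_injective _ (hmono.injective h)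
    set t : ℕ →₀ ℕ := ∑ i : Fin l, Finsupp.single (s i.succ) (p i) with ht
    have happ : ∀ i, t (s i.succ) = p i := by
      intro i
      rw [ht, Finsupp.finsetSum_apply, Finset.sum_eq_single_of_mem i (Finset.mem_univ i)]
      · simp
      · intro j _ hj
        exact Finsupp.single_eq_of_ne fun h => hj (hinj h.symm)
    have hsupp : ∀ k, k ∈ t.support ↔ ∃ i : Fin l, s i.succ = k := by
      intro k
      constructor
      · intro hk
        by_contra! h
        refine Finsupp.mem_support_iff.1 hk ?_
        rw [ht, Finsupp.finsetSum_apply]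
        exact Finset.sum_eq_zero fun i _ => Finsupp.single_eq_of_ne (h i).symm
      · rintro ⟨i, rfl⟩
        rw [Finsupp.mem_support_iff, happ]
        have := (hp i).1
        omega
    refine ⟨t, ?_, ?_, ?_⟩
    · intro k hk
      obtain ⟨i, rfl⟩ := (hsupp k).1 hk
      rw [happ]
      have := (hp i).2
      refine ⟨hn _, by omega, fun k' hk' hlt => ?_⟩
      obtain ⟨j, rfl⟩ := (hsupp k').1 hk'
      -- Every smaller size is at most the preceding one, so the bound against the predecessor
      -- implies all the others.
      have h1 : j.succ ≤ i.castSucc := by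
        have h2 := hmono.lt_iff_lt.1 hlt
        rw [Fin.lt_def, Fin.val_succ, Fin.val_succ] at h2
        rw [Fin.le_def, Fin.val_succ, Fin.val_castSucc]
        omega
      have h2 := hmono.monotone h1
      omega
    · rw [ht, map_sum, ← hd]
      simp
    · rw [chowZMonomial, Finsupp.prod]
      have h1 : t.support = Finset.univ.image fun i : Fin l => s i.succ := by
        ext k
        simp [-Finsupp.mem_support_iff, hsupp]
      rw [h1, Finset.prod_image hinj.injOn]
      exact Finset.prod_congr rfl fun i _ => by rw [happ]
  · rintro ⟨t, ht, rfl, rfl⟩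
    set e := t.support.orderIsoOfFin rfl with he
    have hpos : ∀ k ∈ t.support, 0 < t k := fun k hk =>
      Nat.pos_of_ne_zero (Finsupp.mem_support_iff.1 hk)
    refine ⟨t.support.card, Fin.cons 0 fun i => (e i : ℕ), fun i => t (e i), rfl, ?_, ?_, ?_, ?_⟩
    · intro i
      refine Fin.cases (Nat.zero_le _) (fun i => ?_) i
      exact (ht _ (e i).2).1
    · intro i
      refine ⟨hpos _ (e i).2, ?_⟩
      rw [Fin.cons_succ]
      have h1 := ht _ (e i).2
      rcases Fin.eq_zero_or_eq_succ i.castSucc with h | ⟨j, h⟩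
      · rw [h, Fin.cons_zero, zero_add]
        exact h1.2.1
      · rw [h, Fin.cons_succ]
        have h2 : j < i := by
          have := congrArg Fin.val h
          rw [Fin.val_castSucc, Fin.val_succ] at this
          rw [Fin.lt_def]
          omega
        have h3 := h1.2.2 _ (e j).2 (e.strictMono h2)
        rwa [add_comm] at h3
    · rw [Finsupp.degree_apply, ← Finset.sum_coe_sort t.support]
      exact Equiv.sum_comp e.toEquiv fun k => t k
    · rw [chowZMonomial, Finsupp.prod, ← Finset.prod_coe_sort]
      exact (Equiv.prod_comp e.toEquiv fun k : t.support => chowZ n k ^ t k).symm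

/-! ### Exponent vectors and subsets of `[n-1]` -/

/-- The exponent vector with the exponent `|I_j|` at `b_j + 1` for each maximal interval `I_j`
of `S`, where `b_j = max I_j`. -/
def intervalExponent (S : Finset ℕ) : ℕ →₀ ℕ :=
  ∑ b ∈ rightEnds S, Finsupp.single (b + 1) (intervalEndingAt S b).card

theorem intervalExponent_apply (S : Finset ℕ) {b : ℕ} (hb : b ∈ rightEnds S) :
    intervalExponent S (b + 1) = (intervalEndingAt S b).card := by
  rw [intervalExponent, Finsupp.finsetSum_apply, Finset.sum_eq_single_of_mem b hb]
  · simp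
  · intro c _ hc
    exact Finsupp.single_eq_of_ne (by omega)

theorem card_intervalEndingAt_pos {S : Finset ℕ} {b : ℕ} (hb : b ∈ rightEnds S) :
    0 < (intervalEndingAt S b).card := by
  have hbS := (Finset.mem_filter.1 hb).1
  exact Finset.card_pos.2 ⟨b, Finset.mem_filter.2 ⟨hbS, le_rfl, by simpa using hbS⟩⟩

theorem mem_support_intervalExponent {S : Finset ℕ} {k : ℕ} :
    k ∈ (intervalExponent S).support ↔ ∃ b ∈ rightEnds S, b + 1 = k := by
  constructor
  · intro hk
    by_contra! h
    refine Finsupp.mem_support_iff.1 hk ?_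
    rw [intervalExponent, Finsupp.finsetSum_apply]
    exact Finset.sum_eq_zero fun b hb => Finsupp.single_eq_of_ne (h b hb).symm
  · rintro ⟨b, hb, rfl⟩
    rw [Finsupp.mem_support_iff, intervalExponent_apply S hb]
    exact (card_intervalEndingAt_pos hb).ne'

theorem subsetMonomial_eq (n : ℕ) (S : Finset ℕ) :
    subsetMonomial n S = chowZMonomial n (intervalExponent S) := by
  classical
  have h1 : (intervalExponent S).support = (rightEnds S).image (· + 1) := by
    ext k
    rw [mem_support_intervalExponent, Finset.mem_image]
  rw [subsetMonomial, chowZMonomial, Finsupp.prod, h1,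
    Finset.prod_image (add_left_injective 1).injOn]
  exact Finset.prod_congr rfl fun b hb => by rw [intervalExponent_apply S hb]

/-- The maximal interval ending at `b` is an interval. -/
theorem intervalEndingAt_eq_Ico {S : Finset ℕ} {b : ℕ} (hb : b ∈ S) :
    (intervalEndingAt S b).card ≤ b + 1 ∧
    intervalEndingAt S b = Finset.Ico (b + 1 - (intervalEndingAt S b).card) (b + 1) := by
  classical
  have hex : ∃ a, Finset.Icc a b ⊆ S := ⟨b, by simpa using hb⟩
  have h0 := Nat.find_spec hex
  have hle : Nat.find hex ≤ b := Nat.find_min' hex (by simpa using hb)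
  have h1 : intervalEndingAt S b = Finset.Ico (Nat.find hex) (b + 1) := by
    ext a
    rw [intervalEndingAt, Finset.mem_filter, Finset.mem_Ico]
    constructor
    · rintro ⟨-, h2, h3⟩
      exact ⟨Nat.find_min' hex h3, by omega⟩
    · rintro ⟨h2, h3⟩
      exact ⟨h0 (Finset.mem_Icc.2 ⟨h2, by omega⟩), by omega,
        (Finset.Icc_subset_Icc_left h2).trans h0⟩
  have h2 : (intervalEndingAt S b).card = b + 1 - Nat.find hex := by rw [h1, Nat.card_Ico]
  refine ⟨by omega, ?_⟩
  rw [h2, h1]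
  congr 1
  omega

/-- Every element of a finite set of numbers lies in the maximal interval of some right end. -/
theorem exists_rightEnd {S : Finset ℕ} {a : ℕ} (ha : a ∈ S) :
    ∃ b ∈ rightEnds S, a ∈ intervalEndingAt S b := by
  classical
  have hex : ∃ k, a + k + 1 ∉ S := by
    refine ⟨S.sup id, fun h => ?_⟩
    have := Finset.le_sup (f := id) h
    simp only [id] at this
    omega
  have h0 := Nat.find_spec hex
  have hIcc : Finset.Icc a (a + Nat.find hex) ⊆ S := by
    intro c hc
    rw [Finset.mem_Icc] at hc
    rcases Nat.eq_or_lt_of_le hc.1 with rfl | hlt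
    · exact ha
    · have := Nat.find_min hex (m := c - a - 1) (by omega)
      rw [not_not, show a + (c - a - 1) + 1 = c by omega] at this
      exact this
  exact ⟨a + Nat.find hex, Finset.mem_filter.2 ⟨hIcc (Finset.right_mem_Icc.2 (by omega)), h0⟩,
    Finset.mem_filter.2 ⟨ha, by omega, hIcc⟩⟩

/-- The union of the intervals `[s - t(s), s - 1]` over the support of `t`. -/
def exponentUnion (t : ℕ →₀ ℕ) : Finset ℕ :=
  t.support.biUnion fun s => Finset.Ico (s - t s) s

theorem exponentUnion_intervalExponent (S : Finset ℕ) :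
    exponentUnion (intervalExponent S) = S := by
  ext a
  rw [exponentUnion, Finset.mem_biUnion]
  constructor
  · rintro ⟨s, hs, ha⟩
    obtain ⟨b, hb, rfl⟩ := mem_support_intervalExponent.1 hs
    rw [intervalExponent_apply S hb,
      ← (intervalEndingAt_eq_Ico (Finset.mem_filter.1 hb).1).2] at ha
    exact (Finset.mem_filter.1 ha).1
  · intro ha
    obtain ⟨b, hb, hab⟩ := exists_rightEnd ha
    refine ⟨b + 1, mem_support_intervalExponent.2 ⟨b, hb, rfl⟩, ?_⟩
    rwa [intervalExponent_apply S hb, ← (intervalEndingAt_eq_Ico (Finset.mem_filter.1 hb).1).2]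

theorem disjoint_exponent_intervals {n : ℕ} {t : ℕ →₀ ℕ} (ht : IsFYSizeExponent n t) :
    (t.support : Set ℕ).PairwiseDisjoint fun s => Finset.Ico (s - t s) s := by
  intro s hs s' hs' hne
  rw [Function.onFun, Finset.disjoint_left]
  intro a ha ha'
  rw [Finset.mem_Ico] at ha ha'
  rcases lt_or_gt_of_ne hne with h | h
  · have := (ht s' hs').2.2 s hs h
    omega
  · have := (ht s hs).2.2 s' hs' h
    omega

theorem card_exponentUnion {n : ℕ} {t : ℕ →₀ ℕ} (ht : IsFYSizeExponent n t) :
    (exponentUnion t).card = t.degree := by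
  rw [exponentUnion, Finset.card_biUnion (disjoint_exponent_intervals ht), Finsupp.degree_apply]
  refine Finset.sum_congr rfl fun s hs => ?_
  have := (ht s hs).2.1
  rw [Nat.card_Ico]
  omega

theorem exponentUnion_subset {n : ℕ} {t : ℕ →₀ ℕ} (ht : IsFYSizeExponent n t) :
    exponentUnion t ⊆ Finset.Icc 1 (n - 1) := by
  intro a ha
  obtain ⟨s, hs, ha⟩ := Finset.mem_biUnion.1 ha
  rw [Finset.mem_Ico] at ha
  have := ht s hs
  rw [Finset.mem_Icc]
  omega

/-- By strictness in `t s + s' < s`, the interval of `s` starts beyond `s'`. So `s'`, the point just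
after the interval of `s'`, is uncovered: intervals never touch and remain maximal in the union. -/
theorem mem_rightEnds_exponentUnion {n : ℕ} {t : ℕ →₀ ℕ} (ht : IsFYSizeExponent n t) {b : ℕ} :
    b ∈ rightEnds (exponentUnion t) ↔ b + 1 ∈ t.support := by
  rw [rightEnds, Finset.mem_filter, exponentUnion, Finset.mem_biUnion, Finset.mem_biUnion]
  constructor
  · rintro ⟨⟨s, hs, hb⟩, h⟩
    rw [Finset.mem_Ico] at hb
    by_cases hbs : b + 1 = s
    · rwa [hbs]
    · exact absurd ⟨s, hs, Finset.mem_Ico.2 ⟨by omega, by omega⟩⟩ h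
  · intro hb
    have h1 := Nat.pos_of_ne_zero (Finsupp.mem_support_iff.1 hb)
    refine ⟨⟨b + 1, hb, Finset.mem_Ico.2 ⟨by omega, by omega⟩⟩, ?_⟩
    rintro ⟨s, hs, h⟩
    rw [Finset.mem_Ico] at h
    have := (ht s hs).2.2 (b + 1) hb (by omega)
    omega

theorem card_intervalEndingAt_exponentUnion {n : ℕ} {t : ℕ →₀ ℕ} (ht : IsFYSizeExponent n t)
    {b : ℕ} (hb : b + 1 ∈ t.support) :
    (intervalEndingAt (exponentUnion t) b).card = t (b + 1) := by
  have h1 := ht _ hb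
  have h2 : intervalEndingAt (exponentUnion t) b = Finset.Ico (b + 1 - t (b + 1)) (b + 1) := by
    ext a
    rw [intervalEndingAt, Finset.mem_filter, Finset.mem_Ico]
    constructor
    · rintro ⟨-, h2, h3⟩
      refine ⟨?_, by omega⟩
      by_contra hlt
      -- This is the point just left of the interval, and the subtraction is not truncated since `t
      -- (b + 1) < b + 1`. It lies in no interval, so the maximal interval cannot extend past it.
      have h4 : b - t (b + 1) ∈ exponentUnion t := h3 (Finset.mem_Icc.2 ⟨by omega, by omega⟩)
      obtain ⟨s, hs, h5⟩ := Finset.mem_biUnion.1 h4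
      rw [Finset.mem_Ico] at h5
      rcases lt_trichotomy s (b + 1) with h | h | h
      · have := h1.2.2 s hs h
        omega
      · subst h
        omega
      · have := (ht s hs).2.2 (b + 1) hb h
        omega
    · rintro ⟨h2, h3⟩
      have h4 : Finset.Ico (b + 1 - t (b + 1)) (b + 1) ⊆ exponentUnion t :=
        Finset.subset_biUnion_of_mem (fun s => Finset.Ico (s - t s) s) hb
      refine ⟨h4 (Finset.mem_Ico.2 ⟨h2, h3⟩), by omega, fun c hc => h4 ?_⟩
      rw [Finset.mem_Icc] at hc
      rw [Finset.mem_Ico]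
      omega
  rw [h2, Nat.card_Ico]
  omega

theorem intervalExponent_exponentUnion {n : ℕ} {t : ℕ →₀ ℕ} (ht : IsFYSizeExponent n t) :
    intervalExponent (exponentUnion t) = t := by
  have hs : (intervalExponent (exponentUnion t)).support = t.support := by
    ext k
    rw [mem_support_intervalExponent]
    constructor
    · rintro ⟨b, hb, rfl⟩
      exact (mem_rightEnds_exponentUnion ht).1 hb
    · intro hk
      obtain ⟨b, rfl⟩ := Nat.exists_eq_succ_of_ne_zero
        (show k ≠ 0 by have := (ht k hk).2.1; omega)
      exact ⟨b, (mem_rightEnds_exponentUnion ht).2 hk, rfl⟩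
  refine Finsupp.ext_iff'.2 ⟨hs, fun k hk => ?_⟩
  obtain ⟨b, hb, rfl⟩ := mem_support_intervalExponent.1 hk
  rw [intervalExponent_apply _ hb, card_intervalEndingAt_exponentUnion ht (hs ▸ hk)]

/-- The left end of each interval is at least `1`, which gives `t s < s`. If the gap after a right
end `c` were missing, `c + 1` would lie in `S`. -/
theorem isFYSizeExponent_intervalExponent {n : ℕ} (hn : 1 ≤ n) {S : Finset ℕ}
    (hS : S ⊆ Finset.Icc 1 (n - 1)) : IsFYSizeExponent n (intervalExponent S) := by
  intro s hs
  obtain ⟨b, hb, rfl⟩ := mem_support_intervalExponent.1 hs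
  have hbS := (Finset.mem_filter.1 hb).1
  have hb1 := Finset.mem_Icc.1 (hS hbS)
  obtain ⟨h1, h2⟩ := intervalEndingAt_eq_Ico hbS
  have hpos := card_intervalEndingAt_pos hb
  rw [intervalExponent_apply S hb]
  have hsub : ∀ a, b + 1 - (intervalEndingAt S b).card ≤ a → a < b + 1 → a ∈ S := by
    intro a h3 h4
    have h5 : a ∈ intervalEndingAt S b := by
      rw [h2]
      exact Finset.mem_Ico.2 ⟨h3, h4⟩
    exact (Finset.mem_filter.1 h5).1
  refine ⟨by omega, ?_, fun s' hs' hlt => ?_⟩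
  · have := Finset.mem_Icc.1 (hS (hsub _ le_rfl (by omega)))
    omega
  · obtain ⟨c, hc, rfl⟩ := mem_support_intervalExponent.1 hs'
    by_contra hle
    exact (Finset.mem_filter.1 hc).2 (hsub (c + 1) (by omega) hlt)

theorem bijOn_subsetMonomial {n : ℕ} (hn : 1 ≤ n) (d : ℕ) :
    Set.BijOn (subsetMonomial n)
      {S : Finset ℕ | S ⊆ Finset.Icc 1 (n - 1) ∧ S.card = d} (basisMonomials n d) := by
  have hdeg : ∀ {S : Finset ℕ}, S ⊆ Finset.Icc 1 (n - 1) →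
      (intervalExponent S).degree = S.card := fun {S} hS => by
    rw [← card_exponentUnion (isFYSizeExponent_intervalExponent hn hS),
      exponentUnion_intervalExponent]
  rw [basisMonomials_eq]
  refine ⟨?_, ?_, ?_⟩
  · rintro S ⟨hS, rfl⟩
    exact ⟨_, isFYSizeExponent_intervalExponent hn hS, hdeg hS, (subsetMonomial_eq n S).symm⟩
  · rintro S ⟨hS, -⟩ T ⟨hT, -⟩ h
    rw [subsetMonomial_eq, subsetMonomial_eq] at h
    -- Distinct exponent vectors give distinct ring elements by independence, and `exponentUnion`
    -- then recovers the subset.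
    have h1 := (linearIndependent_chowZMonomial n).injective
      (a₁ := ⟨_, isFYSizeExponent_intervalExponent hn hS⟩)
      (a₂ := ⟨_, isFYSizeExponent_intervalExponent hn hT⟩) h
    rw [← exponentUnion_intervalExponent S, Subtype.mk.inj h1,
      exponentUnion_intervalExponent]
  · rintro _ ⟨t, ht, rfl, rfl⟩
    exact ⟨exponentUnion t, ⟨exponentUnion_subset ht, card_exponentUnion ht⟩, by
      rw [subsetMonomial_eq, intervalExponent_exponentUnion ht]⟩

/-! ### Bases, ranks and the Hilbert series -/

theorem linearIndependent_basisMonomials (n d : ℕ) :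
    LinearIndependent ℤ (fun f : basisMonomials n d => (f : FreeChowRing n)) := by
  refine (linearIndependent_chowZMonomial n).linearIndepOn_id.mono ?_
  rw [basisMonomials_eq]
  rintro _ ⟨t, ht, -, rfl⟩
  exact ⟨⟨t, ht⟩, rfl⟩

theorem ncard_basisMonomials {n : ℕ} (hn : 1 ≤ n) (d : ℕ) :
    (basisMonomials n d).ncard = (n - 1).choose d := by
  have h := bijOn_subsetMonomial hn d
  rw [← h.image_eq, h.injOn.ncard_image]
  have h1 : {S : Finset ℕ | S ⊆ Finset.Icc 1 (n - 1) ∧ S.card = d}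
      = (Finset.powersetCard d (Finset.Icc 1 (n - 1)) : Set (Finset ℕ)) := by
    ext S
    simp [Finset.mem_powersetCard]
  rw [h1, Set.ncard_coe_finset, Finset.card_powersetCard, Nat.card_Icc, Nat.add_sub_cancel]

theorem finite_basisMonomials {n : ℕ} (hn : 1 ≤ n) (d : ℕ) : (basisMonomials n d).Finite := by
  rw [← (bijOn_subsetMonomial hn d).image_eq]
  refine Set.Finite.image _ ((Finset.powersetCard d (Finset.Icc 1 (n - 1))).finite_toSet.subset ?_)
  intro S hS
  exact Finset.mem_coe.2 (Finset.mem_powersetCard.2 hS)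

theorem span_basisMonomials (r n d : ℕ) :
    Submodule.span ℤ (basisMonomials n d) = rankNullityDegree (uniformMatroid r n) d := by
  rw [rankNullityDegree_eq_span, basisMonomials_eq]

/-- The monomials in `basisMonomials n d` form a basis of the degree `d` part. -/
def rankNullityDegreeBasis (r n d : ℕ) :
    Module.Basis (basisMonomials n d) ℤ (rankNullityDegree (uniformMatroid r n) d) :=
  (Module.Basis.span (linearIndependent_basisMonomials n d)).map
    (LinearEquiv.ofEq _ _ (by rw [Subtype.range_coe, span_basisMonomials r n d]))

theorem hilbertFunction_uniformMatroid (r : ℕ) {n : ℕ} (hn : 1 ≤ n) (d : ℕ) :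
    hilbertFunction (uniformMatroid r n) d = (n - 1).choose d := by
  rw [hilbertFunction, Module.finrank_eq_nat_card_basis (rankNullityDegreeBasis r n d),
    ← ncard_basisMonomials hn d, Nat.card_coe_set_eq]

theorem hilbertSeries_uniformMatroid (r : ℕ) {n : ℕ} (hn : 1 ≤ n) :
    hilbertSeries (uniformMatroid r n) = (1 + PowerSeries.X) ^ (n - 1) := by
  ext d
  rw [hilbertSeries, PowerSeries.coeff_mk, hilbertFunction_uniformMatroid r hn]
  have h : ((1 + PowerSeries.X) ^ (n - 1) : PowerSeries ℤ)
      = (((1 + Polynomial.X) ^ (n - 1) : Polynomial ℤ) : PowerSeries ℤ) := by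
    simp
  rw [h, Polynomial.coeff_coe, Polynomial.coeff_one_add_X_pow]

end

theorem mainTheorem6 (r n : ℕ) (hn : 1 ≤ n) (hr : r ≤ n) :
    (rankNullityRing (uniformMatroid r n) : Set (FreeChowRing n)) = chowInvariants n ∧
    (∀ d : ℕ,
      Module.Free ℤ (rankNullityDegree (uniformMatroid r n) d) ∧
      Module.Finite ℤ (rankNullityDegree (uniformMatroid r n) d) ∧
      hilbertFunction (uniformMatroid r n) d = (n - 1).choose d) ∧
    hilbertSeries (uniformMatroid r n) = (1 + PowerSeries.X) ^ (n - 1) ∧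
    (∀ d : ℕ,
      LinearIndependent ℤ (fun f : basisMonomials n d => (f : FreeChowRing n)) ∧
      Submodule.span ℤ (basisMonomials n d) = rankNullityDegree (uniformMatroid r n) d ∧
      Set.BijOn (subsetMonomial n)
        {S : Finset ℕ | S ⊆ Finset.Icc 1 (n - 1) ∧ S.card = d} (basisMonomials n d)) := by
  refine ⟨rankNullityRing_eq_chowInvariants r n, fun d => ⟨?_, ?_, ?_⟩,
    hilbertSeries_uniformMatroid r hn, fun d => ⟨linearIndependent_basisMonomials n d,
      span_basisMonomials r n d, bijOn_subsetMonomial hn d⟩⟩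
  · exact Module.Free.of_basis (rankNullityDegreeBasis r n d)
  · have := (finite_basisMonomials hn d).to_subtype
    exact Module.Finite.of_basis (rankNullityDegreeBasis r n d)
  · exact hilbertFunction_uniformMatroid r hn d
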